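/- Consider the planar system $\dot x=y^3-x^{2k+1}$, $\dot y=-x+my^{2s+1}$, where $m\in\mathbb R$ and $k,s\ge 1$ are integers. A critical point is called an attractor if it is asymptotically stable, and a repeller if it is an attractor for the time-reversed system; a limit cycle is a periodic orbit that has a neighbourhood containing no other periodic orbit. For $n\ge 1$ let $n!!=n\,(n-2)!!$ with $1!!=1$, $2!!=2$, and $n!!!!=n\,(n-4)!!!!$ with $j!!!!=j$ for $1\le j\le 4$. Then: (i) If $s<2k$, the origin is an attractor when $m<0$ and a repeller when $m>0$. (ii) If $s>2k$, the origin is an attractor for every $m\in\mathbb R$. (iii) If $s=2k$, the origin is an attractor when $m<\dfrac{(2k+1)!!}{(4k+1)!!!!}$ and a repeller when $m>\dfrac{(2k+1)!!}{(4k+1)!!!!}$. Moreover, for $k=1$, $s=2$ and $m=3/5$ the origin is a repeller, and for $k=1$, $s=2$ and $m\lesssim 3/5$ the system has at least one limit cycle near the origin: for every $\varepsilon>0$ there is $\eta>0$ such that for every $m\in(3/5-\eta,3/5)$ the system has a limit cycle contained in the ball of radius $\varepsilon$ centred at the origin. -/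

import Mathlib

open Set Filter Topology

/-- The quadruple factorial `n!!!! = n (n - 4)!!!!`, with `j!!!! = j` for `1 ≤ j ≤ 4`
(the value at `0` is the empty product, which makes `4!!!! = 4`). -/
def quadFactorial : ℕ → ℕ
  | 0 => 1
  | 1 => 1
  | 2 => 2
  | 3 => 3
  | n + 4 => (n + 4) * quadFactorial n

/-- The vector field of the planar system `x' = y³ - x^(2k+1)`, `y' = -x + m y^(2s+1)`. -/
def planarField (k s : ℕ) (m : ℝ) (z : ℝ × ℝ) : ℝ × ℝ :=
  (z.2 ^ 3 - z.1 ^ (2 * k + 1), -z.1 + m * z.2 ^ (2 * s + 1))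

section Dynamics

variable {E : Type*} [NormedAddCommGroup E] [NormedSpace ℝ E]

/-- `γ` solves the autonomous equation `z' = F z` on `[0, ∞)` with `γ 0 = q`. -/
def IsForwardSolution (F : E → E) (q : E) (γ : ℝ → E) : Prop :=
  γ 0 = q ∧ IsIntegralCurveOn γ (fun _ => F) (Ici 0)

/-- `p` is an attractor (asymptotically stable) for `z' = F z`: for every `ε > 0` there is
`δ > 0` such that for every initial condition `q` in the `δ`-ball around `p` a solution on
`[0, ∞)` exists, and every such solution stays `ε`-close to `p` for all `t ≥ 0` and
converges to `p` as `t → +∞`. -/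
def IsAttractor (F : E → E) (p : E) : Prop :=
  ∀ ε > 0, ∃ δ > 0, ∀ q : E, dist q p < δ →
    (∃ γ : ℝ → E, IsForwardSolution F q γ) ∧
    ∀ γ : ℝ → E, IsForwardSolution F q γ →
      (∀ t : ℝ, 0 ≤ t → dist (γ t) p < ε) ∧ Tendsto γ atTop (𝓝 p)

/-- `p` is a repeller for `z' = F z`: it is an attractor after reversing time. -/
def IsRepeller (F : E → E) (p : E) : Prop :=
  IsAttractor (fun z => -F z) p

/-- `Γ` is a periodic orbit: the orbit of a nonconstant periodic solution. -/
def IsPeriodicOrbit (F : E → E) (Γ : Set E) : Prop :=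
  ∃ (γ : ℝ → E) (T : ℝ), 0 < T ∧ IsIntegralCurve γ (fun _ => F) ∧ Function.Periodic γ T ∧
    (∃ t : ℝ, γ t ≠ γ 0) ∧ range γ = Γ

/-- `Γ` is a limit cycle: a periodic orbit that is isolated, in that it has a neighbourhood
which contains no other periodic orbit. -/
def IsLimitCycle (F : E → E) (Γ : Set E) : Prop :=
  IsPeriodicOrbit F Γ ∧
    ∃ U : Set E, IsOpen U ∧ Γ ⊆ U ∧ ∀ Γ' : Set E, IsPeriodicOrbit F Γ' → Γ' ⊆ U → Γ' = Γ

end Dynamics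

/-! ### Ordinary differential equations: global solutions and Lyapunov's theorem. -/

section ODE

variable {E : Type*} [NormedAddCommGroup E] [NormedSpace ℝ E]

/-! Stability. Give `x` weight 2 and `y` weight 1. The lowest part of the field is the Hamiltonian
centre `x' = y³`, `y' = -x` with energy `H = x²/2 + y⁴/4`; along it differentiation raises the
weight by 1, while the two remaining terms raise it by `4k` and `2s`. Along the full field `H' =
-x^(2k+2) + m y^(2s+4)`, which is only semidefinite or indefinite. Along the centre, `(x^a y^b)' = a
x^(a-1) y^(b+3) - b x^(a+1) y^(b-1)`, so modulo such derivatives `x^(2k+2)` may be replaced by `M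
y^(4k+4)` with `M = (2k+1)!!/(4k+1)!!!!` (`exists_corrector`, `reductionCoeff_eq`). Adding `θ` times
the corrector to `H` gives a function with derivative `(θ-1) x^(2k+2) + m y^(2s+4) - θ M y^(4k+4)`
plus terms of higher weight (`isAttractor_smul_planarField`). The three cases are choices of `θ`
that make this definite. At `k = 1`, `s = 2`, `m = 3/5` the leading term cancels, and correctors of
weights 7, 10 and 13 push the computation to the first term with a sign, `(96/1925) y^14`.

Limit cycle. Let `C`, `S` parametrize `2c² + s⁴ = 1` by the flow of the centre and put `x = ρ² C`,
`y = ρ S`, `u = ρ^(-3)`. With the angle as time, `u' = -3A u/(u - B) = -3A - 3AB/u - 3AB²/u² - ...`.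
The mean of `A` over a turn vanishes at `m = 3/5`, `AB` always has a periodic primitive, and the
next order carries a positive focal quantity. For `m` slightly below `3/5`, a turn therefore
decreases `u` at moderately large `u` (`radial_return_lt`) and increases it at very large `u`
(`radial_return_gt`), so the return map has a fixed point by the intermediate value theorem.

Isolation uses the same focal density. For two distinct radial solutions over the same angle, `log
|u₁ - u₂|` with periodic corrections is strictly increasing (`strictMono_log_radial`), which is
impossible if both close up. Hence a small punctured ball contains only one periodic orbit
(`periodicOrbit_eq_polarCurve`). -/

open scoped NNReal in
theorem exists_isIntegralCurve_of_bounded_lipschitz [CompleteSpace E] {v : ℝ → E → E} {K M : ℝ≥0}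
    (hL : ∀ t, LipschitzWith K (v t)) (hc : ∀ x, Continuous (fun t => v t x))
    (hb : ∀ t x, ‖v t x‖ ≤ M) (x₀ : E) :
    ∃ γ : ℝ → E, γ 0 = x₀ ∧ IsIntegralCurve γ v := by
  have loc : ∀ n : ℕ, ∃ α : ℝ → E, α 0 = x₀ ∧
      ∀ t ∈ Ioo (-((n : ℝ) + 1)) (n + 1), HasDerivAt α (v t (α t)) t := by
    intro n
    have hn : (0 : ℝ) ≤ n := n.cast_nonneg
    have hpl : IsPicardLindelof v (tmin := -((n : ℝ) + 1)) (tmax := (n : ℝ) + 1)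
        ⟨0, by constructor <;> linarith⟩ x₀ (M * (n + 1)) 0 M K :=
      { lipschitzOnWith := fun t _ => (hL t).lipschitzOnWith
        continuousOn := fun x _ => (hc x).continuousOn
        norm_le := fun t _ x _ => hb t x
        mul_max_le := by simp }
    obtain ⟨α, h0, h1⟩ := hpl.exists_eq_forall_mem_Icc_hasDerivWithinAt₀
    exact ⟨α, h0, fun t ht => (h1 t (Ioo_subset_Icc_self ht)).hasDerivAt
      (Icc_mem_nhds ht.1 ht.2)⟩
  choose α h0 h1 using loc
  have cons : ∀ n m : ℕ, n ≤ m → ∀ t ∈ Ioo (-((n : ℝ) + 1)) (n + 1), α n t = α m t := by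
    intro n m hnm t ht
    have hn : (0 : ℝ) ≤ n := n.cast_nonneg
    have hnm' : (n : ℝ) ≤ m := by exact_mod_cast hnm
    refine ODE_solution_unique_of_mem_Ioo (v := v) (s := fun _ => univ) (K := K) (t₀ := 0)
      (fun t _ => (hL t).lipschitzOnWith) ⟨by linarith, by linarith⟩
      (fun t ht => ⟨h1 n t ht, mem_univ _⟩)
      (fun t ht => ⟨h1 m t ⟨by linarith [ht.1], by linarith [ht.2]⟩, mem_univ _⟩)
      (by rw [h0, h0]) ht
  -- The local solution of index `⌈|t|⌉₊` lives on an open interval of half-length one more than the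
  -- index, so it covers a neighbourhood of `t`; there the glued function agrees with it by
  -- uniqueness.
  refine ⟨fun t => α ⌈|t|⌉₊ t, by simp [h0], fun t => ?_⟩
  have hlt : ∀ s : ℝ, s ∈ Ioo (-((⌈|s|⌉₊ : ℝ) + 1)) (⌈|s|⌉₊ + 1) := fun s => by
    have := Nat.le_ceil |s|
    have h2 := abs_le.1 this
    constructor <;> linarith [h2.1, h2.2]
  have hev : (fun s => α ⌈|s|⌉₊ s) =ᶠ[𝓝 t] α ⌈|t|⌉₊ := by
    filter_upwards [Ioo_mem_nhds (hlt t).1 (hlt t).2] with s hs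
    rcases le_total ⌈|s|⌉₊ ⌈|t|⌉₊ with h | h
    · exact cons _ _ h s (hlt s)
    · exact (cons _ _ h s hs).symm
  exact (h1 _ t (hlt t)).congr_of_eventuallyEq hev

/-- At a first exit time the point lies on the sphere, where `V ≥ v₀`, although `V` has not
increased from a value below `v₀`. The field `G` is arbitrary so that the result also confines
solutions of a clamped field, before they are known to solve the original equation. -/
theorem norm_lt_of_lyapunov {G : E → E} {V : E → ℝ} {V' : E → E →L[ℝ] ℝ}
    (hV : ∀ z, HasFDerivAt V (V' z) z) {ε v₀ : ℝ} (hs : ∀ z, ‖z‖ = ε → v₀ ≤ V z)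
    (hn : ∀ z, ‖z‖ ≤ ε → V' z (G z) ≤ 0) {γ : ℝ → E}
    (hγ : IsIntegralCurveOn γ (fun _ => G) (Ici 0)) (h0 : ‖γ 0‖ < ε) (hv : V (γ 0) < v₀) :
    ∀ t, 0 ≤ t → ‖γ t‖ < ε := by
  intro t ht
  by_contra! hcon
  have hcont : ContinuousOn γ (Ici 0) := hγ.continuousOn
  set S := {s ∈ Icc 0 t | ε ≤ ‖γ s‖} with hS
  have hcl : IsClosed S := by
    have : ContinuousOn (fun s => ‖γ s‖) (Icc 0 t) :=
      (hcont.mono Icc_subset_Ici_self).norm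
    exact this.preimage_isClosed_of_isClosed isClosed_Icc isClosed_Ici
  have hcomp : IsCompact S := isCompact_Icc.of_isClosed_subset hcl (fun s hs => hs.1)
  obtain ⟨t₁, ht₁, hleast⟩ := hcomp.exists_isLeast ⟨t, ⟨⟨ht, le_rfl⟩, hcon⟩⟩
  have hlt : ∀ s, 0 ≤ s → s < t₁ → ‖γ s‖ < ε := by
    intro s hs hst
    by_contra! h
    exact absurd (hleast ⟨⟨hs, hst.le.trans ht₁.1.2⟩, h⟩) (not_le.2 hst)
  have ht₁0 : 0 ≤ t₁ := ht₁.1.1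
  have hpos : 0 < t₁ := by
    rcases ht₁0.lt_or_eq with h | h
    · exact h
    · have := ht₁.2
      rw [← h] at this
      linarith
  have hle : ‖γ t₁‖ ≤ ε := by
    have hc1 : ContinuousWithinAt γ (Iio t₁) t₁ :=
      ((hγ t₁ ht₁0).continuousWithinAt.continuousAt (Ici_mem_nhds hpos)).continuousWithinAt
    have hlim : Tendsto (fun s => ‖γ s‖) (𝓝[<] t₁) (𝓝 ‖γ t₁‖) := hc1.norm
    refine le_of_tendsto hlim ?_
    filter_upwards [Ioo_mem_nhdsLT hpos] with s hs
    exact (hlt s hs.1.le hs.2).le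
  have heq : ‖γ t₁‖ = ε := le_antisymm hle ht₁.2
  have hanti : AntitoneOn (fun s => V (γ s)) (Icc 0 t₁) := by
    have hd : ∀ s ∈ Ioo 0 t₁, HasDerivAt (fun s => V (γ s)) (V' (γ s) (G (γ s))) s := by
      intro s hs
      exact (hV (γ s)).comp_hasDerivAt s ((hγ s hs.1.le).hasDerivAt (Ici_mem_nhds hs.1))
    refine antitoneOn_of_deriv_nonpos (convex_Icc 0 t₁) ?_ ?_ ?_
    · intro s hs
      exact ((hV (γ s)).continuousAt.comp_continuousWithinAt
        ((hγ s hs.1).continuousWithinAt.mono Icc_subset_Ici_self))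
    · rw [interior_Icc]
      exact fun s hs => (hd s hs).differentiableAt.differentiableWithinAt
    · rw [interior_Icc]
      intro s hs
      rw [(hd s hs).deriv]
      exact hn _ (hlt s hs.1.le hs.2).le
  have := hanti ⟨le_rfl, ht₁0⟩ ⟨ht₁0, le_rfl⟩ ht₁0
  have h3 := hs _ heq
  simp only at this
  linarith

/-- Coordinatewise projection of the plane onto the square of half-side `R`. -/
def squareClamp (R : ℝ) (z : ℝ × ℝ) : ℝ × ℝ :=
  (max (-R) (min R z.1), max (-R) (min R z.2))

theorem squareClamp_eq {R : ℝ} {z : ℝ × ℝ} (hz : ‖z‖ ≤ R) : squareClamp R z = z := by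
  rw [Prod.norm_def, max_le_iff, Real.norm_eq_abs, Real.norm_eq_abs, abs_le, abs_le] at hz
  simp [squareClamp, hz.1.1, hz.1.2, hz.2.1, hz.2.2]

theorem norm_squareClamp_le {R : ℝ} (hR : 0 ≤ R) (z : ℝ × ℝ) : ‖squareClamp R z‖ ≤ R := by
  rw [Prod.norm_def, max_le_iff, Real.norm_eq_abs, Real.norm_eq_abs, abs_le, abs_le]
  simp only [squareClamp]
  refine ⟨⟨le_max_left _ _, ?_⟩, ⟨le_max_left _ _, ?_⟩⟩ <;>
    exact max_le (by linarith) (min_le_left _ _)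

theorem lipschitzWith_squareClamp (R : ℝ) : LipschitzWith 1 (squareClamp R) := by
  have h1 : LipschitzWith 1 (fun t : ℝ => max (-R) (min R t)) :=
    (LipschitzWith.id.const_min R).const_max (-R)
  have := (h1.comp LipschitzWith.prod_fst).prodMk (h1.comp LipschitzWith.prod_snd)
  simpa [squareClamp] using! this

-- Composing a `C¹` field with the projection onto a square makes it globally Lipschitz and bounded,
-- hence complete. A solution that stays in the square solves the original equation.
open scoped NNReal in
theorem exists_isIntegralCurve_clamp {F : ℝ × ℝ → ℝ × ℝ} (hF : ContDiff ℝ 1 F) {R : ℝ}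
    (hR : 0 ≤ R) (q : ℝ × ℝ) :
    ∃ γ : ℝ → ℝ × ℝ, γ 0 = q ∧ IsIntegralCurve γ (fun _ z => F (squareClamp R z)) := by
  obtain ⟨K, hK⟩ := hF.contDiffOn.exists_lipschitzOnWith (s := Metric.closedBall 0 R) one_ne_zero
    (convex_closedBall _ _) (isCompact_closedBall _ _)
  obtain ⟨M, hM⟩ := (isCompact_closedBall (0 : ℝ × ℝ) R).exists_bound_of_continuousOn
    hF.continuous.continuousOn
  have hmem : ∀ z, squareClamp R z ∈ Metric.closedBall (0 : ℝ × ℝ) R := fun z => by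
    simpa using norm_squareClamp_le hR z
  refine exists_isIntegralCurve_of_bounded_lipschitz (v := fun _ z => F (squareClamp R z)) (K := K)
    (M := M.toNNReal) (fun t => ?_)
    (fun x => continuous_const) (fun t x => (hM _ (hmem x)).trans (Real.le_coe_toNNReal M)) q
  have := hK.comp ((lipschitzWith_squareClamp R).lipschitzOnWith (s := univ)) (fun z _ => hmem z)
  rw [lipschitzOnWith_univ, mul_one] at this
  exact this

theorem isAttractor_of_lyapunov {F : ℝ × ℝ → ℝ × ℝ} (hF : ContDiff ℝ 1 F) {V : ℝ × ℝ → ℝ}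
    {V' : ℝ × ℝ → ℝ × ℝ →L[ℝ] ℝ} (hV : ∀ z, HasFDerivAt V (V' z) z)
    (hc : Continuous fun z => V' z (F z)) (hF0 : F 0 = 0) (hV0 : V 0 = 0) {R : ℝ} (hR : 0 < R)
    (hpos : ∀ z, z ≠ 0 → ‖z‖ ≤ R → 0 < V z) (hneg : ∀ z, z ≠ 0 → ‖z‖ ≤ R → V' z (F z) < 0) :
    IsAttractor F 0 := by
  have hVc : Continuous V := continuous_iff_continuousAt.2 fun z => (hV z).continuousAt
  have hneg' : ∀ z, ‖z‖ ≤ R → V' z (F z) ≤ 0 := by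
    intro z hz
    by_cases h : z = 0
    · rw [h, hF0, map_zero]
    · exact (hneg z h hz).le
  have hsph : ∀ ε, 0 < ε → ε ≤ R → ∃ v₀ > 0, ∀ z : ℝ × ℝ, ‖z‖ = ε → v₀ ≤ V z := by
    intro ε hε hεR
    have hcomp := isCompact_sphere (0 : ℝ × ℝ) ε
    have hne : (Metric.sphere (0 : ℝ × ℝ) ε).Nonempty := NormedSpace.sphere_nonempty.2 hε.le
    obtain ⟨z, hz, hmin⟩ := hcomp.exists_isMinOn hne hVc.continuousOn
    rw [mem_sphere_zero_iff_norm] at hz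
    refine ⟨V z, hpos z (norm_ne_zero_iff.1 (by linarith)) (hz.le.trans hεR), fun w hw => ?_⟩
    exact hmin (mem_sphere_zero_iff_norm.2 hw)
  intro ε₀ hε₀
  set ε := min ε₀ R with hεdef
  have hε : 0 < ε := lt_min hε₀ hR
  have hεR : ε ≤ R := min_le_right _ _
  obtain ⟨v₀, hv₀, hsv⟩ := hsph ε hε hεR
  obtain ⟨δ₁, hδ₁, hδV⟩ := Metric.continuousAt_iff.1 (hVc.continuousAt (x := 0)) v₀ hv₀
  refine ⟨min δ₁ ε, lt_min hδ₁ hε, fun q hq => ?_⟩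
  have hq1 : V q < v₀ := by
    have := hδV (hq.trans_le (min_le_left _ _))
    rw [hV0, Real.dist_eq, sub_zero] at this
    exact (le_abs_self _).trans_lt this
  have hq2 : ‖q‖ < ε := by
    rw [← dist_zero_right]
    exact hq.trans_le (min_le_right _ _)
  have stay : ∀ γ : ℝ → ℝ × ℝ, IsForwardSolution F q γ → ∀ t, 0 ≤ t → ‖γ t‖ < ε :=
    fun γ hγ => norm_lt_of_lyapunov hV hsv (fun z hz => hneg' z (hz.trans hεR)) hγ.2
      (by rw [hγ.1]; exact hq2) (by rw [hγ.1]; exact hq1)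
  constructor
  · obtain ⟨γ, h0, hγ⟩ := exists_isIntegralCurve_clamp hF hR.le q
    have hst := norm_lt_of_lyapunov (G := fun z => F (squareClamp R z)) hV hsv
      (fun z hz => by
        rw [squareClamp_eq (hz.trans hεR)]
        exact hneg' z (hz.trans hεR)) (hγ.isIntegralCurveOn (Ici 0))
      (by rw [h0]; exact hq2) (by rw [h0]; exact hq1)
    refine ⟨γ, h0, fun t ht => ?_⟩
    have := (hγ t).hasDerivWithinAt (s := Ici 0)
    simpa [squareClamp_eq ((hst t ht).le.trans hεR)] using this
  · intro γ hγ
    have hst := stay γ hγ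
    refine ⟨fun t ht => by rw [dist_zero_right]; exact (hst t ht).trans_le (min_le_left _ _), ?_⟩
    have hd : ∀ s, 0 < s → HasDerivAt (fun s => V (γ s)) (V' (γ s) (F (γ s))) s := fun s hs =>
      (hV (γ s)).comp_hasDerivAt s ((hγ.2 s hs.le).hasDerivAt (Ici_mem_nhds hs))
    have hVγc : ContinuousOn (fun s => V (γ s)) (Ici 0) :=
      hVc.comp_continuousOn hγ.2.continuousOn
    have hanti : AntitoneOn (fun s => V (γ s)) (Ici 0) := by
      refine antitoneOn_of_deriv_nonpos (convex_Ici 0) hVγc ?_ ?_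
      · rw [interior_Ici]
        exact fun s hs => (hd s hs).differentiableAt.differentiableWithinAt
      · rw [interior_Ici]
        intro s hs
        rw [(hd s hs).deriv]
        exact hneg' _ ((hst s (le_of_lt hs)).le.trans hεR)
    have hcone : ∀ r, 0 < r → ∃ t, 0 ≤ t ∧ V (γ t) < r := by
      intro r hr
      by_contra! hcon
      -- If `V` stayed above `r`, the trajectory would remain in this compact set without the
      -- origin, where the derivative of `V` is at most some `c < 0`; then `V` would be nonpositive
      -- by time `V (γ 0) / (-c)`.
      set T := {z : ℝ × ℝ | ‖z‖ ≤ ε ∧ r ≤ V z} with hT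
      have hTc : IsCompact T := by
        refine (isCompact_closedBall (0 : ℝ × ℝ) ε).of_isClosed_subset ?_ ?_
        · exact (isClosed_le continuous_norm continuous_const).inter
            (isClosed_le continuous_const hVc)
        · intro z hz
          simpa using hz.1
      have hne : T.Nonempty := ⟨γ 0, (hst 0 le_rfl).le, hcon 0 le_rfl⟩
      obtain ⟨z, hz, hmax⟩ := hTc.exists_isMaxOn hne hc.continuousOn
      have hz0 : z ≠ 0 := by
        rintro rfl
        have := hz.2
        rw [hV0] at this
        linarith
      set c := V' z (F z) with hcdef
      have hcneg : c < 0 := hneg z hz0 (hz.1.trans hεR)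
      have hlin : ∀ t, 0 ≤ t → V (γ t) - V (γ 0) ≤ c * (t - 0) := by
        intro t ht
        refine (convex_Ici (0 : ℝ)).image_sub_le_mul_sub_of_deriv_le (f := fun s => V (γ s)) hVγc
          ?_ ?_ 0 self_mem_Ici t ht ht
        · rw [interior_Ici]
          exact fun s hs => (hd s hs).differentiableAt.differentiableWithinAt
        · rw [interior_Ici]
          intro s hs
          rw [(hd s hs).deriv]
          exact hmax ⟨(hst s (le_of_lt hs)).le, hcon s (le_of_lt hs)⟩
      have h0r := hcon 0 le_rfl
      have ht : 0 ≤ V (γ 0) / (-c) := div_nonneg (hr.le.trans h0r) (by linarith)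
      have h1 := hlin _ ht
      have h2 := hcon _ ht
      have h3 : c * (V (γ 0) / (-c) - 0) = - V (γ 0) := by
        have := hcneg.ne
        rw [sub_zero, div_neg, mul_neg, mul_div_cancel₀ _ this]
      linarith
    rw [Metric.tendsto_atTop]
    intro ρ hρ
    set ρ' := min (ρ / 2) ε with hρ'
    have hρ'0 : 0 < ρ' := lt_min (by linarith) hε
    have hcompact : IsCompact (Metric.closedBall (0 : ℝ × ℝ) ε \ Metric.ball 0 ρ') :=
      (isCompact_closedBall _ _).diff Metric.isOpen_ball
    have hlow : ∃ r > 0, ∀ z : ℝ × ℝ, ‖z‖ ≤ ε → ρ' ≤ ‖z‖ → r ≤ V z := by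
      have hne : (Metric.closedBall (0 : ℝ × ℝ) ε \ Metric.ball 0 ρ').Nonempty := by
        obtain ⟨w, hw⟩ := (NormedSpace.sphere_nonempty (x := (0 : ℝ × ℝ))).2 hε.le
        rw [mem_sphere_zero_iff_norm] at hw
        refine ⟨w, by simp [hw], ?_⟩
        simp [hw, hρ']
      obtain ⟨z, hz, hmin⟩ := hcompact.exists_isMinOn hne hVc.continuousOn
      have hzε : ‖z‖ ≤ ε := by simpa using hz.1
      have hzρ : ρ' ≤ ‖z‖ := by simpa using hz.2
      refine ⟨V z, hpos z (norm_ne_zero_iff.1 (by linarith)) (hzε.trans hεR), fun w h1 h2 => ?_⟩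
      exact hmin ⟨by simpa using h1, by simpa using h2⟩
    obtain ⟨r, hr, hrV⟩ := hlow
    obtain ⟨t₀, ht₀, hVt⟩ := hcone r hr
    refine ⟨t₀, fun t ht => ?_⟩
    rw [dist_zero_right]
    have h0t : 0 ≤ t := ht₀.trans ht
    by_contra! hbig
    have h1 := hrV (γ t) (hst t h0t).le
      ((min_le_left _ _).trans (le_trans (by linarith) hbig))
    have h2 := hanti ht₀ h0t ht
    simp only at h2
    linarith

end ODE

/-! ### Quasi-homogeneous estimates for the weights (2, 1). -/

section WeightedBounds

/-- The quasi-homogeneous gauge of the plane for the weights `2` of `x` and `1` of `y`. -/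
noncomputable def gauge21 (z : ℝ × ℝ) : ℝ := max (√|z.1|) |z.2|

theorem gauge21_nonneg (z : ℝ × ℝ) : 0 ≤ gauge21 z :=
  (abs_nonneg _).trans (le_max_right _ _)

theorem abs_fst_le_gauge21 (z : ℝ × ℝ) : |z.1| ≤ gauge21 z ^ 2 := by
  have h : √|z.1| ≤ gauge21 z := le_max_left _ _
  calc |z.1| = √|z.1| ^ 2 := (Real.sq_sqrt (abs_nonneg _)).symm
    _ ≤ _ := by gcongr

theorem abs_snd_le_gauge21 (z : ℝ × ℝ) : |z.2| ≤ gauge21 z := le_max_right _ _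

theorem gauge21_pow_le (n : ℕ) (z : ℝ × ℝ) :
    gauge21 z ^ (4 * n) ≤ z.1 ^ (2 * n) + z.2 ^ (4 * n) := by
  have h1 : (0 : ℝ) ≤ z.1 ^ (2 * n) := (even_two_mul n).pow_nonneg _
  have h2' : Even (4 * n) := ⟨2 * n, by ring⟩
  have h2 : (0 : ℝ) ≤ z.2 ^ (4 * n) := h2'.pow_nonneg _
  rcases max_choice (√|z.1|) |z.2| with h | h
  · rw [gauge21, h, show 4 * n = 2 * (2 * n) by ring, pow_mul, Real.sq_sqrt (abs_nonneg _),
      (even_two_mul n).pow_abs, ← show 4 * n = 2 * (2 * n) by ring]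
    linarith
  · rw [gauge21, h, h2'.pow_abs]
    linarith

theorem gauge21_le_sqrt {z : ℝ × ℝ} (hz : ‖z‖ ≤ 1) : gauge21 z ≤ √‖z‖ := by
  have h1 : |z.1| ≤ ‖z‖ := norm_fst_le z
  have h2 : |z.2| ≤ ‖z‖ := norm_snd_le z
  refine max_le (Real.sqrt_le_sqrt h1) (h2.trans ?_)
  refine Real.le_sqrt_of_sq_le ?_
  nlinarith [norm_nonneg z]

theorem gauge21_le_one {z : ℝ × ℝ} (hz : ‖z‖ ≤ 1) : gauge21 z ≤ 1 :=
  (gauge21_le_sqrt hz).trans (Real.sqrt_le_one.2 hz)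

theorem gauge21_pos {z : ℝ × ℝ} (hz : z ≠ 0) : 0 < gauge21 z := by
  refine (gauge21_nonneg z).lt_of_ne' fun h => hz ?_
  have h1 := abs_fst_le_gauge21 z
  have h2 := abs_snd_le_gauge21 z
  rw [h] at h1 h2
  have h1' : z.1 = 0 := abs_eq_zero.1 (le_antisymm (by simpa using h1) (abs_nonneg _))
  have h2' : z.2 = 0 := abs_eq_zero.1 (le_antisymm h2 (abs_nonneg _))
  exact Prod.ext h1' h2'

/-- On the unit ball, `f` is bounded by a multiple of the `d`-th power of the gauge. -/
def WeightedBound (f : ℝ × ℝ → ℝ) (d : ℕ) : Prop :=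
  ∃ K : ℝ, ∀ z, ‖z‖ ≤ 1 → |f z| ≤ K * gauge21 z ^ d

namespace WeightedBound

variable {f g : ℝ × ℝ → ℝ} {d e : ℕ}

theorem zero (d : ℕ) : WeightedBound (fun _ => 0) d := ⟨0, fun z _ => by simp⟩

theorem monomial (c : ℝ) (a b : ℕ) :
    WeightedBound (fun z => c * z.1 ^ a * z.2 ^ b) (2 * a + b) := by
  refine ⟨|c|, fun z _ => ?_⟩
  rw [abs_mul, abs_mul, abs_pow, abs_pow, pow_add, pow_mul, mul_assoc]
  have h1 := abs_fst_le_gauge21 z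
  have h2 := abs_snd_le_gauge21 z
  gcongr

theorem add (hf : WeightedBound f d) (hg : WeightedBound g d) :
    WeightedBound (fun z => f z + g z) d := by
  obtain ⟨K, hK⟩ := hf
  obtain ⟨L, hL⟩ := hg
  refine ⟨K + L, fun z hz => (abs_add_le _ _).trans ?_⟩
  rw [add_mul]
  exact add_le_add (hK z hz) (hL z hz)

theorem mul (hf : WeightedBound f d) (hg : WeightedBound g e) :
    WeightedBound (fun z => f z * g z) (d + e) := by
  obtain ⟨K, hK⟩ := hf
  obtain ⟨L, hL⟩ := hg
  refine ⟨K * L, fun z hz => ?_⟩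
  rw [abs_mul, pow_add, mul_mul_mul_comm]
  exact mul_le_mul (hK z hz) (hL z hz) (abs_nonneg _) ((abs_nonneg _).trans (hK z hz))

theorem const_mul (c : ℝ) (hf : WeightedBound f d) : WeightedBound (fun z => c * f z) d := by
  obtain ⟨K, hK⟩ := hf
  refine ⟨|c| * K, fun z hz => ?_⟩
  rw [abs_mul, mul_assoc]
  exact mul_le_mul_of_nonneg_left (hK z hz) (abs_nonneg _)

theorem mono (hf : WeightedBound f d) (h : e ≤ d) : WeightedBound f e := by
  obtain ⟨K, hK⟩ := hf
  refine ⟨|K|, fun z hz => (hK z hz).trans ?_⟩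
  have h1 := pow_le_pow_of_le_one (gauge21_nonneg z) (gauge21_le_one hz) h
  have h2 := pow_nonneg (gauge21_nonneg z) d
  exact mul_le_mul (le_abs_self K) h1 h2 (abs_nonneg _)

theorem monomial_of_le (c : ℝ) (a b : ℕ) (h : d ≤ 2 * a + b) :
    WeightedBound (fun z => c * z.1 ^ a * z.2 ^ b) d := (monomial c a b).mono h

end WeightedBound

/-- The energy is at least a quarter of the fourth power of the gauge, so a perturbation of weight 5
does not spoil its positivity near the origin; likewise `f`, one weight higher, is absorbed by the
negative term. -/
theorem isAttractor_of_weightedBound {F : ℝ × ℝ → ℝ × ℝ} (hF : ContDiff ℝ 1 F) {V : ℝ × ℝ → ℝ}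
    {V' : ℝ × ℝ → ℝ × ℝ →L[ℝ] ℝ} (hV : ∀ z, HasFDerivAt V (V' z) z)
    (hc : Continuous fun z => V' z (F z)) (hF0 : F 0 = 0) (hV0 : V 0 = 0)
    {g f : ℝ × ℝ → ℝ} (hg : WeightedBound g 5) (hVg : ∀ z, V z = z.1 ^ 2 / 2 + z.2 ^ 4 / 4 + g z)
    {n : ℕ} (hf : WeightedBound f (n + 1)) {c : ℝ} (hcpos : 0 < c)
    (hd : ∀ z, ‖z‖ ≤ 1 → V' z (F z) ≤ -c * gauge21 z ^ n + f z) :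
    IsAttractor F 0 := by
  obtain ⟨K, hK⟩ := hg
  obtain ⟨L, hL⟩ := hf
  -- Gauge at most `δ` makes both perturbations smaller than the main terms. The radius is `δ ^ 2`
  -- because the gauge is bounded by the square root of the norm.
  set δ := min (1 / (8 * (|K| + 1))) (c / (2 * (|L| + 1))) with hδ
  have hK1 := abs_nonneg K
  have hL1 := abs_nonneg L
  have hδ0 : 0 < δ := by
    refine lt_min (by positivity) (by positivity)
  have key : ∀ z, z ≠ 0 → ‖z‖ ≤ min 1 (δ ^ 2) → ‖z‖ ≤ 1 ∧ 0 < gauge21 z ∧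
      |K| * gauge21 z < 1 / 4 ∧ |L| * gauge21 z < c := by
    intro z hz hzR
    have hz1 : ‖z‖ ≤ 1 := hzR.trans (min_le_left _ _)
    have hr : gauge21 z ≤ δ := by
      refine (gauge21_le_sqrt hz1).trans ?_
      rw [Real.sqrt_le_left hδ0.le]
      exact hzR.trans (min_le_right _ _)
    have hr1 : gauge21 z ≤ 1 / (8 * (|K| + 1)) := hr.trans (min_le_left _ _)
    have hr2 : gauge21 z ≤ c / (2 * (|L| + 1)) := hr.trans (min_le_right _ _)
    rw [le_div_iff₀ (by positivity)] at hr1 hr2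
    have hp := gauge21_pos hz
    refine ⟨hz1, hp, by nlinarith, by nlinarith⟩
  refine isAttractor_of_lyapunov hF hV hc hF0 hV0 (R := min 1 (δ ^ 2)) (by positivity) ?_ ?_
  · intro z hz hzR
    obtain ⟨hz1, hp, h1, -⟩ := key z hz hzR
    have h2 := gauge21_pow_le 1 z
    have h3 := (abs_le.1 (hK z hz1)).1
    norm_num at h2
    rw [hVg]
    have h4 : K * gauge21 z ^ 5 ≤ |K| * gauge21 z * gauge21 z ^ 4 := by
      have := mul_le_mul_of_nonneg_right (le_abs_self K) (pow_nonneg hp.le 5)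
      linarith
    have h5 : |K| * gauge21 z * gauge21 z ^ 4 < 1 / 4 * gauge21 z ^ 4 := by gcongr
    have h6 := sq_nonneg z.1
    linarith
  · intro z hz hzR
    obtain ⟨hz1, hp, -, h1⟩ := key z hz hzR
    have h2 := hd z hz1
    have h3 := (abs_le.1 (hL z hz1)).2
    have h4 : L * gauge21 z ^ (n + 1) ≤ |L| * gauge21 z * gauge21 z ^ n := by
      have := mul_le_mul_of_nonneg_right (le_abs_self L) (pow_nonneg hp.le (n + 1))
      rw [pow_succ] at this ⊢
      linarith
    have h5 : |L| * gauge21 z * gauge21 z ^ n < c * gauge21 z ^ n := by gcongr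
    linarith

end WeightedBounds

/-! ### Reduction of monomials modulo derivatives along the Hamiltonian centre. -/

section Correctors

/-- The linear form on the plane with coefficients `a` and `b`. -/
noncomputable def planeForm (a b : ℝ) : ℝ × ℝ →L[ℝ] ℝ :=
  a • ContinuousLinearMap.fst ℝ ℝ ℝ + b • ContinuousLinearMap.snd ℝ ℝ ℝ

@[simp] theorem planeForm_apply (a b : ℝ) (w : ℝ × ℝ) : planeForm a b w = a * w.1 + b * w.2 := by
  simp [planeForm]

theorem planeForm_add (a b a' b' : ℝ) :
    planeForm a b + planeForm a' b' = planeForm (a + a') (b + b') := by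
  ext <;> simp

theorem smul_planeForm (c a b : ℝ) : c • planeForm a b = planeForm (c * a) (c * b) := by
  ext <;> simp

theorem hasFDerivAt_monomial (a b : ℕ) (z : ℝ × ℝ) :
    HasFDerivAt (fun z : ℝ × ℝ => z.1 ^ a * z.2 ^ b)
      (planeForm (a * z.1 ^ (a - 1) * z.2 ^ b) (b * z.1 ^ a * z.2 ^ (b - 1))) z := by
  have h := ((hasFDerivAt_fst (𝕜 := ℝ) (p := z)).pow a).mul ((hasFDerivAt_snd (𝕜 := ℝ) (p := z)).pow b)
  refine h.congr_fderiv ?_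
  ext <;> simp <;> ring

/-- The coefficient of `y ^ (n + 4 * i)` in the reduction of `x ^ (2 * i) * y ^ n` modulo
derivatives along `x' = y ^ 3`, `y' = -x`. -/
noncomputable def reductionCoeff : ℕ → ℕ → ℝ
  | 0, _ => 1
  | i + 1, n => (2 * i + 1) / (n + 1) * reductionCoeff i (n + 4)

/-- Along the centre, `x^(2i+1) y^(n+1)` has derivative `(2i+1) x^(2i) y^(n+4) - (n+1) x^(2i+2)
y^n`, which trades two powers of `x` for four of `y`; iterate until no `x` is left. The subtractions
in the weights can truncate only for `i = 0`, where all three functions vanish. -/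
theorem exists_corrector (i n : ℕ) : ∃ g gx gy : ℝ × ℝ → ℝ,
    (∀ z, HasFDerivAt g (planeForm (gx z) (gy z)) z) ∧ Continuous gx ∧ Continuous gy ∧ g 0 = 0 ∧
    (∀ z : ℝ × ℝ, gx z * z.2 ^ 3 - gy z * z.1 =
      z.1 ^ (2 * i) * z.2 ^ n - reductionCoeff i n * z.2 ^ (n + 4 * i)) ∧
    WeightedBound g (4 * i + n - 1) ∧ WeightedBound gx (4 * i + n - 3) ∧
    WeightedBound gy (4 * i + n - 2) := by
  induction i generalizing n with
  | zero =>
    refine ⟨fun _ => 0, fun _ => 0, fun _ => 0, fun z => ?_, continuous_const, continuous_const,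
      rfl, fun z => by simp [reductionCoeff], .zero _, .zero _, .zero _⟩
    refine (hasFDerivAt_const (0 : ℝ) z).congr_fderiv ?_
    ext <;> simp
  | succ i ih =>
    obtain ⟨g, gx, gy, hd, hcx, hcy, h0, heq, hg, hgx, hgy⟩ := ih (n + 4)
    have hn : (n : ℝ) + 1 ≠ 0 := by positivity
    -- With this `p`, the derivative of `p x^(2i+1) y^(n+1)` is `x^(2i+2) y^n - q x^(2i) y^(n+4)`;
    -- the inductive corrector, scaled by `q`, removes the second term.
    set p : ℝ := -1 / (n + 1) with hp
    set q : ℝ := (2 * i + 1) / (n + 1) with hq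
    refine ⟨fun z => p * (z.1 ^ (2 * i + 1) * z.2 ^ (n + 1)) + q * g z,
      fun z => p * ((2 * i + 1 : ℕ) * z.1 ^ (2 * i) * z.2 ^ (n + 1)) + q * gx z,
      fun z => p * ((n + 1 : ℕ) * z.1 ^ (2 * i + 1) * z.2 ^ n) + q * gy z, ?_, by fun_prop,
      by fun_prop, by simp [h0], ?_, ?_, ?_, ?_⟩
    · intro z
      have h := ((hasFDerivAt_monomial (2 * i + 1) (n + 1) z).const_mul p).add ((hd z).const_mul q)
      refine h.congr_fderiv ?_
      rw [smul_planeForm, smul_planeForm, planeForm_add]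
      simp
    · intro z
      have h1 := heq z
      have h2 : p * (n + 1) = -1 := by rw [hp]; field_simp
      have h3 : p * (2 * i + 1) = -q := by rw [hp, hq]; ring
      have e1 : z.2 ^ (n + 4 * (i + 1)) = z.2 ^ (n + 4 + 4 * i) := by congr 1; ring
      simp only [reductionCoeff]
      rw [e1, ← hq]
      push_cast
      have e2 : z.1 ^ (2 * (i + 1)) = z.1 ^ (2 * i + 1) * z.1 := by ring
      have e3 : z.2 ^ (n + 4) = z.2 ^ (n + 1) * z.2 ^ 3 := by ring
      rw [e3] at h1
      rw [e2]
      linear_combination q * h1 + z.1 ^ (2 * i) * z.2 ^ (n + 1) * z.2 ^ 3 * h3 -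
        z.1 ^ (2 * i + 1) * z.1 * z.2 ^ n * h2
    · refine WeightedBound.add ?_ ((hg.const_mul q).mono (by omega))
      have := WeightedBound.monomial_of_le (d := 4 * (i + 1) + n - 1) p (2 * i + 1) (n + 1)
        (by omega)
      simpa only [mul_assoc] using this
    · refine WeightedBound.add ?_ ((hgx.const_mul q).mono (by omega))
      have := WeightedBound.monomial_of_le (d := 4 * (i + 1) + n - 3)
        (p * ((2 * i + 1 : ℕ) : ℝ)) (2 * i) (n + 1) (by omega)
      simpa only [mul_assoc] using this
    · refine WeightedBound.add ?_ ((hgy.const_mul q).mono (by omega))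
      have := WeightedBound.monomial_of_le (d := 4 * (i + 1) + n - 2)
        (p * ((n + 1 : ℕ) : ℝ)) (2 * i + 1) n (by omega)
      simpa only [mul_assoc] using this

theorem reductionCoeff_pos (i n : ℕ) : 0 < reductionCoeff i n := by
  induction i generalizing n with
  | zero => exact one_pos
  | succ i ih => exact mul_pos (by positivity) (ih _)

theorem quadFactorial_pos (n : ℕ) : 0 < quadFactorial n := by
  induction n using quadFactorial.induct <;> simp_all [quadFactorial]

/-- The coefficient is the quotient of `(2i+1)!!` by the product of `4l+1` for `j ≤ l ≤ j+i`. A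
general starting index `j` is needed because the recursion raises `n` by 4; the factor `4j+1` on the
left avoids writing `(4j-3)!!!!`. -/
theorem reductionCoeff_succ_mul_quadFactorial (i j : ℕ) :
    reductionCoeff (i + 1) (4 * j) * quadFactorial (4 * (j + i) + 1) * (4 * j + 1) =
      (Nat.doubleFactorial (2 * i + 1) : ℝ) * quadFactorial (4 * j + 1) := by
  induction i generalizing j with
  | zero =>
    have : (4 * (j : ℝ) + 1) ≠ 0 := by positivity
    simp [reductionCoeff]
    field_simp
  | succ i ih =>
    have h := ih (j + 1)
    have hj : (4 * (j : ℝ) + 1) ≠ 0 := by positivity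
    have hj' : (4 * ((j : ℝ) + 1) + 1) ≠ 0 := by positivity
    have e1 : quadFactorial (4 * (j + 1) + 1) = (4 * (j + 1) + 1) * quadFactorial (4 * j + 1) :=
      rfl
    have e2 : Nat.doubleFactorial (2 * (i + 1) + 1) =
      (2 * i + 3) * Nat.doubleFactorial (2 * i + 1) := rfl
    have e3 : reductionCoeff (i + 1 + 1) (4 * j) =
        (2 * ((i + 1 : ℕ) : ℝ) + 1) / (((4 * j : ℕ) : ℝ) + 1) *
          reductionCoeff (i + 1) (4 * (j + 1)) := rfl
    rw [e1, show j + 1 + i = j + (i + 1) by ring] at h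
    rw [e2, e3]
    push_cast at h ⊢
    have h' : reductionCoeff (i + 1) (4 * (j + 1)) * (quadFactorial (4 * (j + (i + 1)) + 1) : ℝ) =
        (Nat.doubleFactorial (2 * i + 1) : ℝ) * quadFactorial (4 * j + 1) := by
      apply mul_right_cancel₀ hj'
      linear_combination h
    field_simp
    linear_combination (2 * (i + 1) + 1 : ℝ) * h'

theorem reductionCoeff_eq (k : ℕ) : reductionCoeff (k + 1) 0 =
    (Nat.doubleFactorial (2 * k + 1) : ℝ) / (quadFactorial (4 * k + 1) : ℝ) := by
  have h := reductionCoeff_succ_mul_quadFactorial k 0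
  have hq : (quadFactorial (4 * k + 1) : ℝ) ≠ 0 := by exact_mod_cast (quadFactorial_pos _).ne'
  rw [eq_div_iff hq]
  simpa [quadFactorial] using h

end Correctors

/-! ### Lyapunov functions for the three cases and for the critical parameter. -/

section Stability

theorem contDiff_planarField (k s : ℕ) (m : ℝ) {n : WithTop ℕ∞} :
    ContDiff ℝ n (planarField k s m) := by
  unfold planarField
  fun_prop

theorem planarField_zero (k s : ℕ) (m : ℝ) : planarField k s m 0 = 0 := by
  simp [planarField]

theorem hasFDerivAt_energy (z : ℝ × ℝ) :
    HasFDerivAt (fun z : ℝ × ℝ => z.1 ^ 2 / 2 + z.2 ^ 4 / 4) (planeForm z.1 (z.2 ^ 3)) z := by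
  have h := ((hasFDerivAt_monomial 2 0 z).const_mul (1 / 2)).add
    ((hasFDerivAt_monomial 0 4 z).const_mul (1 / 4))
  rw [smul_planeForm, smul_planeForm, planeForm_add] at h
  refine (h.congr_fderiv ?_).congr_of_eventuallyEq (Eventually.of_forall fun z => ?_)
  · congr 1 <;> norm_num <;> ring
  · simp
    ring

/-- Reduces stability to a polynomial inequality. The sign `σ` covers both time directions, with the
same positive definite function `H + θ g`. -/
theorem isAttractor_smul_planarField {k s : ℕ} (hk : 1 ≤ k) (hs : 1 ≤ s) (m σ θ : ℝ) {c : ℝ}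
    (hc : 0 < c) {f : ℝ × ℝ → ℝ} (hf : WeightedBound f (4 * k + 5))
    (h : ∀ x y : ℝ, |y| ≤ 1 → σ * ((θ - 1) * x ^ (2 * k + 2) + m * y ^ (2 * s + 4) -
      θ * reductionCoeff (k + 1) 0 * y ^ (4 * k + 4)) ≤
        -c * (x ^ (2 * k + 2) + y ^ (4 * k + 4)) + f (x, y)) :
    IsAttractor (fun z => σ • planarField k s m z) 0 := by
  obtain ⟨g, gx, gy, hd, hcx, hcy, h0, heq, hg, hgx, hgy⟩ := exists_corrector (k + 1) 0
  -- The non-Hamiltonian terms acting on the corrector. Their weights are at least `8k+3` and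
  -- `4k+2s+3`, hence at least `4k+5` as `k, s ≥ 1`.
  set e : ℝ × ℝ → ℝ := fun z =>
    σ * (θ * (gx z * (-1 * z.1 ^ (2 * k + 1) * z.2 ^ 0) +
      gy z * (m * z.1 ^ 0 * z.2 ^ (2 * s + 1)))) with he
  have hebd : WeightedBound e (4 * k + 5) := by
    refine (WeightedBound.const_mul θ ?_).const_mul σ
    exact ((hgx.mul (.monomial (-1) (2 * k + 1) 0)).mono (by omega)).add
      ((hgy.mul (.monomial m 0 (2 * s + 1))).mono (by omega))
  refine isAttractor_of_weightedBound (V := fun z => z.1 ^ 2 / 2 + z.2 ^ 4 / 4 + θ * g z)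
    (V' := fun z => planeForm (z.1 + θ * gx z) (z.2 ^ 3 + θ * gy z)) (g := fun z => θ * g z)
    (n := 4 * k + 4) (f := fun z => f z + e z) (c := c) ?_ ?_ ?_ ?_ ?_ ?_ ?_ (hf.add hebd) hc ?_
  · exact (contDiff_const (c := σ)).smul (contDiff_planarField k s m)
  · intro z
    have := (hasFDerivAt_energy z).add ((hd z).const_mul θ)
    rwa [smul_planeForm, planeForm_add] at this
  · simp only [planeForm_apply, planarField, Prod.smul_fst, Prod.smul_snd, smul_eq_mul]
    fun_prop
  · simp [planarField_zero]
  · simp [h0]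
  · exact (hg.const_mul θ).mono (by omega)
  · intro z
    rfl
  · intro z hz
    have hy : |z.2| ≤ 1 := (norm_snd_le z).trans hz
    have h1 := h z.1 z.2 hy
    have h2 := gauge21_pow_le (k + 1) z
    have h3 := heq z
    rw [show 2 * (k + 1) = 2 * k + 2 by ring, show 4 * (k + 1) = 4 * k + 4 by ring] at h2
    rw [show 2 * (k + 1) = 2 * k + 2 by ring, show 0 + 4 * (k + 1) = 4 * k + 4 by ring,
      pow_zero, mul_one] at h3
    have h4 : planeForm (z.1 + θ * gx z) (z.2 ^ 3 + θ * gy z) (σ • planarField k s m z) =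
        σ * ((θ - 1) * z.1 ^ (2 * k + 2) + m * z.2 ^ (2 * s + 4) -
          θ * reductionCoeff (k + 1) 0 * z.2 ^ (4 * k + 4)) + e z := by
      simp only [planeForm_apply, planarField, Prod.smul_fst, Prod.smul_snd, he, smul_eq_mul]
      have e1 : z.1 ^ (2 * k + 2) = z.1 ^ (2 * k + 1) * z.1 := by ring
      have e2 : z.2 ^ (2 * s + 4) = z.2 ^ (2 * s + 1) * z.2 ^ 3 := by ring
      rw [e1] at h3 ⊢
      rw [e2]
      linear_combination σ * θ * h3
    have h5 := mul_le_mul_of_nonneg_left h2 hc.le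
    rw [h4]
    change _ ≤ -c * gauge21 z ^ (4 * k + 4) + (f z + e z)
    linarith

theorem isAttractor_planarField_of {k s : ℕ} (hk : 1 ≤ k) (hs : 1 ≤ s) (m θ : ℝ) {c : ℝ}
    (hc : 0 < c) {f : ℝ × ℝ → ℝ} (hf : WeightedBound f (4 * k + 5))
    (h : ∀ x y : ℝ, |y| ≤ 1 → (θ - 1) * x ^ (2 * k + 2) + m * y ^ (2 * s + 4) -
      θ * reductionCoeff (k + 1) 0 * y ^ (4 * k + 4) ≤
        -c * (x ^ (2 * k + 2) + y ^ (4 * k + 4)) + f (x, y)) :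
    IsAttractor (planarField k s m) 0 := by
  have := isAttractor_smul_planarField hk hs m 1 θ hc hf (by simpa using! h)
  simpa using this

theorem isRepeller_planarField_of {k s : ℕ} (hk : 1 ≤ k) (hs : 1 ≤ s) (m θ : ℝ) {c : ℝ}
    (hc : 0 < c) {f : ℝ × ℝ → ℝ} (hf : WeightedBound f (4 * k + 5))
    (h : ∀ x y : ℝ, |y| ≤ 1 → c * (x ^ (2 * k + 2) + y ^ (4 * k + 4)) - f (x, y) ≤
      (θ - 1) * x ^ (2 * k + 2) + m * y ^ (2 * s + 4) -
      θ * reductionCoeff (k + 1) 0 * y ^ (4 * k + 4)) :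
    IsRepeller (planarField k s m) 0 := by
  have := isAttractor_smul_planarField hk hs m (-1) θ hc hf (fun x y hy => by
    have := h x y hy
    linarith)
  simpa [IsRepeller] using this

theorem isAttractor_planarField_of_lt {k s : ℕ} {m : ℝ} (hk : 1 ≤ k) (hs : 1 ≤ s)
    (hm : m < 0) : IsAttractor (planarField k s m) 0 := by
  have hM := reductionCoeff_pos (k + 1) 0
  set M := reductionCoeff (k + 1) 0 with hMdef
  refine isAttractor_planarField_of hk hs m (1 / 2) (c := min (1 / 2) (M / 2))
    (by positivity) (.zero _) (fun x y _ => ?_)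
  rw [← hMdef]
  have hx : 0 ≤ x ^ (2 * k + 2) := Even.pow_nonneg ⟨k + 1, by ring⟩ x
  have hy : 0 ≤ y ^ (4 * k + 4) := Even.pow_nonneg ⟨2 * k + 2, by ring⟩ y
  have hy' : 0 ≤ y ^ (2 * s + 4) := Even.pow_nonneg ⟨s + 2, by ring⟩ y
  have h1 := mul_le_mul_of_nonneg_right (min_le_left (1 / 2) (M / 2)) hx
  have h2 := mul_le_mul_of_nonneg_right (min_le_right (1 / 2) (M / 2)) hy
  have h3 := mul_nonneg (neg_nonneg.2 hm.le) hy'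
  linarith

theorem isRepeller_planarField_of_lt {k s : ℕ} {m : ℝ} (hk : 1 ≤ k) (hs : 1 ≤ s)
    (hks : s < 2 * k) (hm : 0 < m) : IsRepeller (planarField k s m) 0 := by
  have hM := reductionCoeff_pos (k + 1) 0
  set M := reductionCoeff (k + 1) 0 with hMdef
  set L := 2 * M + 1 with hL
  -- For `|y| ≤ 1` and `s < 2k`, `y^(2s+4) ≥ y^(4k+2)`. Completing the square in `m y^(4k+2) - L
  -- y^(4k+4)` costs exactly this term, of weight `4k+6`; the value `L = 2M + 1` leaves a margin
  -- `y^(4k+4)` for `θ = 2`.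
  have hf : WeightedBound (fun z : ℝ × ℝ => L ^ 2 / (4 * m) * z.1 ^ 0 * z.2 ^ (4 * k + 6))
      (4 * k + 5) := .monomial_of_le _ _ _ (by omega)
  refine isRepeller_planarField_of hk hs m 2 (c := 1) one_pos hf (fun x y hy => ?_)
  rw [← hMdef]
  have hx : 0 ≤ x ^ (2 * k + 2) := Even.pow_nonneg ⟨k + 1, by ring⟩ x
  have hyk : 0 ≤ y ^ (4 * k + 2) := Even.pow_nonneg ⟨2 * k + 1, by ring⟩ y
  have h1 : y ^ (4 * k + 2) ≤ y ^ (2 * s + 4) := by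
    have e1 : Even (4 * k + 2) := ⟨2 * k + 1, by ring⟩
    have e2 : Even (2 * s + 4) := ⟨s + 2, by ring⟩
    rw [← e1.pow_abs, ← e2.pow_abs]
    exact pow_le_pow_of_le_one (abs_nonneg y) hy (by omega)
  have h2 := mul_le_mul_of_nonneg_left h1 hm.le
  have h3 : 0 ≤ m * (1 - L * y ^ 2 / (2 * m)) ^ 2 * y ^ (4 * k + 2) := by positivity
  have h4 : m * (1 - L * y ^ 2 / (2 * m)) ^ 2 * y ^ (4 * k + 2) = m * y ^ (4 * k + 2) -
      L * y ^ (4 * k + 4) + L ^ 2 / (4 * m) * y ^ (4 * k + 6) := by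
    field_simp
    ring
  simp only [pow_zero, mul_one]
  linarith

theorem isAttractor_planarField_of_gt {k s : ℕ} (m : ℝ) (hk : 1 ≤ k) (hs : 1 ≤ s)
    (hks : 2 * k < s) : IsAttractor (planarField k s m) 0 := by
  have hM := reductionCoeff_pos (k + 1) 0
  set M := reductionCoeff (k + 1) 0 with hMdef
  have hf : WeightedBound (fun z : ℝ × ℝ => m * z.1 ^ 0 * z.2 ^ (2 * s + 4))
      (4 * k + 5) := .monomial_of_le _ _ _ (by omega)
  refine isAttractor_planarField_of hk hs m (1 / 2) (c := min (1 / 2) (M / 2))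
    (by positivity) hf (fun x y _ => ?_)
  rw [← hMdef]
  have hx : 0 ≤ x ^ (2 * k + 2) := Even.pow_nonneg ⟨k + 1, by ring⟩ x
  have hy : 0 ≤ y ^ (4 * k + 4) := Even.pow_nonneg ⟨2 * k + 2, by ring⟩ y
  have h1 := mul_le_mul_of_nonneg_right (min_le_left (1 / 2) (M / 2)) hx
  have h2 := mul_le_mul_of_nonneg_right (min_le_right (1 / 2) (M / 2)) hy
  simp only [pow_zero, mul_one]
  linarith

theorem isAttractor_planarField_of_lt_critical {k : ℕ} {m : ℝ} (hk : 1 ≤ k)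
    (hm : m < reductionCoeff (k + 1) 0) : IsAttractor (planarField k (2 * k) m) 0 := by
  rcases lt_or_ge m 0 with hm0 | hm0
  · exact isAttractor_planarField_of_lt hk (by omega) hm0
  have hM := reductionCoeff_pos (k + 1) 0
  set M := reductionCoeff (k + 1) 0 with hMdef
  -- With `θ = 1 - c` the coefficient of `x^(2k+2)` is `-c`, and that of `y^(4k+4)` is `m - M + cM`;
  -- it is at most `-c` when `c (M + 1) ≤ M - m`. Half of the limiting value is taken.
  set c := (M - m) / (2 * (M + 1)) with hc
  have hc0 : 0 < c := div_pos (by linarith) (by positivity)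
  have hc1 : c * (M + 1) = (M - m) / 2 := by
    rw [hc]
    field_simp
  refine isAttractor_planarField_of hk (by omega) m (1 - c) hc0 (.zero _) (fun x y _ => ?_)
  rw [← hMdef, show 2 * (2 * k) + 4 = 4 * k + 4 by ring]
  have hy : 0 ≤ y ^ (4 * k + 4) := Even.pow_nonneg ⟨2 * k + 2, by ring⟩ y
  have h1 : 0 ≤ (M - m) / 2 * y ^ (4 * k + 4) := mul_nonneg (by linarith) hy
  have h2 : c * (M + 1) * y ^ (4 * k + 4) = (M - m) / 2 * y ^ (4 * k + 4) := by rw [hc1]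
  linarith

theorem isRepeller_planarField_of_gt_critical {k : ℕ} {m : ℝ} (hk : 1 ≤ k)
    (hm : reductionCoeff (k + 1) 0 < m) : IsRepeller (planarField k (2 * k) m) 0 := by
  have hM := reductionCoeff_pos (k + 1) 0
  set M := reductionCoeff (k + 1) 0 with hMdef
  set c := (m - M) / (2 * (M + 1)) with hc
  have hc0 : 0 < c := div_pos (by linarith) (by positivity)
  have hc1 : c * (M + 1) = (m - M) / 2 := by
    rw [hc]
    field_simp
  refine isRepeller_planarField_of hk (by omega) m (1 + c) hc0 (.zero _) (fun x y _ => ?_)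
  rw [← hMdef, show 2 * (2 * k) + 4 = 4 * k + 4 by ring]
  have hy : 0 ≤ y ^ (4 * k + 4) := Even.pow_nonneg ⟨2 * k + 2, by ring⟩ y
  have h1 : 0 ≤ (m - M) / 2 * y ^ (4 * k + 4) := mul_nonneg (by linarith) hy
  have h2 : c * (M + 1) * y ^ (4 * k + 4) = (m - M) / 2 * y ^ (4 * k + 4) := by rw [hc1]
  linarith

/-- The polynomial part of the Lyapunov function at the critical parameter `m = 3 / 5`. -/
noncomputable def criticalPoly (z : ℝ × ℝ) : ℝ :=
  -1 * z.1 ^ 3 * z.2 ^ 1 + -(3 / 5) * z.1 ^ 1 * z.2 ^ 5 + 3 / 2 * z.1 ^ 4 * z.2 ^ 2 +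
    1 * z.1 ^ 2 * z.2 ^ 6 + 1 / 50 * z.1 ^ 0 * z.2 ^ 10 + -2 * z.1 ^ 5 * z.2 ^ 3 +
    -(51 / 35) * z.1 ^ 3 * z.2 ^ 7 + -(27 / 385) * z.1 ^ 1 * z.2 ^ 11

/-- The partial derivative of `criticalPoly` with respect to `x`. -/
noncomputable def criticalPolyX (z : ℝ × ℝ) : ℝ :=
  -3 * z.1 ^ 2 * z.2 - 3 / 5 * z.2 ^ 5 + 6 * z.1 ^ 3 * z.2 ^ 2 + 2 * z.1 * z.2 ^ 6 -
    10 * z.1 ^ 4 * z.2 ^ 3 - 153 / 35 * z.1 ^ 2 * z.2 ^ 7 - 27 / 385 * z.2 ^ 11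

/-- The partial derivative of `criticalPoly` with respect to `y`. -/
noncomputable def criticalPolyY (z : ℝ × ℝ) : ℝ :=
  -z.1 ^ 3 - 3 * z.1 * z.2 ^ 4 + 3 * z.1 ^ 4 * z.2 + 6 * z.1 ^ 2 * z.2 ^ 5 +
    1 / 5 * z.2 ^ 9 - 6 * z.1 ^ 5 * z.2 ^ 2 - 51 / 5 * z.1 ^ 3 * z.2 ^ 6 -
    27 / 35 * z.1 * z.2 ^ 10

theorem hasFDerivAt_criticalPoly (z : ℝ × ℝ) :
    HasFDerivAt criticalPoly (planeForm (criticalPolyX z) (criticalPolyY z)) z := by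
  have H : ∀ (c : ℝ) (a b : ℕ), HasFDerivAt (fun z : ℝ × ℝ => c * z.1 ^ a * z.2 ^ b)
      (planeForm (c * (a * z.1 ^ (a - 1) * z.2 ^ b)) (c * (b * z.1 ^ a * z.2 ^ (b - 1)))) z := by
    intro c a b
    have := (hasFDerivAt_monomial a b z).const_mul c
    rw [smul_planeForm] at this
    simpa only [mul_assoc] using this
  have h := ((((((((H (-1) 3 1).add (H (-(3 / 5)) 1 5)).add (H (3 / 2) 4 2)).add
    (H 1 2 6)).add (H (1 / 50) 0 10)).add (H (-2) 5 3)).add (H (-(51 / 35)) 3 7)).add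
    (H (-(27 / 385)) 1 11))
  simp only [planeForm_add] at h
  refine h.congr_fderiv ?_
  congr 1 <;> norm_num [criticalPolyX, criticalPolyY] <;> ring

/-- Here the non-Hamiltonian terms raise weights by 4. The parts of `criticalPoly` of weights 7 and
10 cancel the terms of weights 8 and 11 in the derivative, and its part of weight 13 reduces weight
14 to `(96/1925) y^14`. This is not definite, so a corrector of `x^8` adds definiteness at weight
16, still below the remainder of weight 17. -/
theorem isRepeller_planarField_critical : IsRepeller (planarField 1 2 (3 / 5)) 0 := by
  obtain ⟨g, gx, gy, hd, hcx, hcy, h0, heq, hg, hgx, hgy⟩ := exists_corrector 4 0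
  have hM := reductionCoeff_pos 4 0
  set M := reductionCoeff 4 0 with hMdef
  -- The corrector contributes `θ x^8 - θ M y^16`. Since `y^14 ≥ y^16` on the unit ball, half of
  -- `(96/1925) y^14` pays for the negative term and half gives definiteness in `y`.
  set θ : ℝ := 48 / 1925 / M with hθ
  have hθ0 : 0 < θ := by positivity
  have hθM : θ * M = 48 / 1925 := by
    rw [hθ]
    field_simp
  set e : ℝ × ℝ → ℝ := fun z => θ * (gx z * (1 * z.1 ^ 3 * z.2 ^ 0)) +
    θ * (gy z * (-(3 / 5) * z.1 ^ 0 * z.2 ^ 5)) + -10 * z.1 ^ 7 * z.2 ^ 3 +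
    -(27 / 35) * z.1 ^ 5 * z.2 ^ 7 + 11646 / 1925 * z.1 ^ 3 * z.2 ^ 11 +
    81 / 175 * z.1 ^ 1 * z.2 ^ 15 with he
  have hebd : WeightedBound e 17 :=
    ((((((hgx.mul (.monomial 1 3 0)).const_mul θ).mono (by norm_num)).add
      (((hgy.mul (.monomial (-(3 / 5)) 0 5)).const_mul θ).mono (by norm_num))).add
      (.monomial_of_le _ _ _ (by norm_num))).add (.monomial_of_le _ _ _ (by norm_num))).add
      (.monomial_of_le _ _ _ (by norm_num)) |>.add (.monomial_of_le _ _ _ (by norm_num))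
  have hcrit : WeightedBound criticalPoly 5 :=
    ((((((WeightedBound.monomial_of_le _ _ _ (by norm_num)).add
      (.monomial_of_le _ _ _ (by norm_num))).add (.monomial_of_le _ _ _ (by norm_num))).add
      (.monomial_of_le _ _ _ (by norm_num))).add (.monomial_of_le _ _ _ (by norm_num))).add
      (.monomial_of_le _ _ _ (by norm_num))).add (.monomial_of_le _ _ _ (by norm_num)) |>.add
      (.monomial_of_le _ _ _ (by norm_num))
  refine isAttractor_of_weightedBound
    (V := fun z => z.1 ^ 2 / 2 + z.2 ^ 4 / 4 + (criticalPoly z + θ * g z))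
    (V' := fun z => planeForm (z.1 + (criticalPolyX z + θ * gx z))
      (z.2 ^ 3 + (criticalPolyY z + θ * gy z))) (g := fun z => criticalPoly z + θ * g z)
    (n := 16) (f := e) (c := min θ (48 / 1925)) ?_ ?_ ?_ ?_ ?_ ?_ ?_ hebd (by positivity) ?_
  · exact (contDiff_planarField 1 2 (3 / 5)).neg
  · intro z
    have := (hasFDerivAt_energy z).add
      ((hasFDerivAt_criticalPoly z).add ((hd z).const_mul θ))
    rw [smul_planeForm, planeForm_add, planeForm_add] at this
    exact this
  · simp only [planeForm_apply, planarField, Prod.fst_neg, Prod.snd_neg,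
      criticalPolyX, criticalPolyY]
    fun_prop
  · simp [planarField_zero]
  · simp [h0, criticalPoly]
  · exact hcrit.add ((hg.const_mul θ).mono (by norm_num))
  · intro z
    rfl
  · intro z hz
    have hy : |z.2| ≤ 1 := (norm_snd_le z).trans hz
    have h2 := gauge21_pow_le 4 z
    have h3 := heq z
    norm_num at h2 h3
    have h4 : z.2 ^ 16 ≤ z.2 ^ 14 := by
      rw [← Even.pow_abs (by decide : Even 16), ← Even.pow_abs (by decide : Even 14)]
      exact pow_le_pow_of_le_one (abs_nonneg _) hy (by norm_num)
    have hx : 0 ≤ z.1 ^ 8 := Even.pow_nonneg (by decide) _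
    have hy16 : 0 ≤ z.2 ^ 16 := Even.pow_nonneg (by decide) _
    have h5 := mul_le_mul_of_nonneg_right (min_le_left θ (48 / 1925)) hx
    have h6 := mul_le_mul_of_nonneg_right (min_le_right θ (48 / 1925)) hy16
    have h7 := mul_le_mul_of_nonneg_left h2 (lt_min hθ0 (by norm_num : (0 : ℝ) < 48 / 1925)).le
    have h8 : ∀ {a b : ℝ}, planeForm a b (-planarField 1 2 (3 / 5) z) =
        -(a * (z.2 ^ 3 - z.1 ^ 3) + b * (-z.1 + 3 / 5 * z.2 ^ 5)) := by
      intro a b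
      simp only [planeForm_apply, planarField, Prod.fst_neg, Prod.snd_neg]
      ring
    rw [h8]
    have h9 : 48 / 1925 * z.2 ^ 16 = θ * M * z.2 ^ 16 := by rw [hθM]
    simp only [he, criticalPolyX, criticalPolyY]
    generalize min θ (48 / 1925) = c at *
    linear_combination -θ * h3 + h5 + h6 + h7 + 96 / 1925 * h4 - h9

end Stability

/-! ### Generalized trigonometric functions of the Hamiltonian centre. -/

section QuasiTrig

/-- `C` and `S` solve `C' = S ^ 3`, `S' = -C` on the level curve `2 * C ^ 2 + S ^ 4 = 1`, which
they parametrize with minimal period `T`. -/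
structure IsQuasiTrig (C S : ℝ → ℝ) (T : ℝ) : Prop where
  pos : 0 < T
  hasDerivAt_fst : ∀ t, HasDerivAt C (S t ^ 3) t
  hasDerivAt_snd : ∀ t, HasDerivAt S (-C t) t
  curve : ∀ t, 2 * C t ^ 2 + S t ^ 4 = 1
  periodic_fst : Function.Periodic C T
  periodic_snd : Function.Periodic S T
  injective : ∀ a b, C a = C b → S a = S b → ∃ n : ℤ, b = a + n * T
  surjective : ∀ c s : ℝ, 2 * c ^ 2 + s ^ 4 = 1 → ∃ t, C t = c ∧ S t = s

theorem abs_le_one_of_curve {c s : ℝ} (h : 2 * c ^ 2 + s ^ 4 = 1) : |c| ≤ 1 ∧ |s| ≤ 1 := by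
  constructor
  · rw [← sq_le_one_iff_abs_le_one]
    nlinarith [sq_nonneg (s ^ 2)]
  · rw [← sq_le_one_iff_abs_le_one]
    nlinarith [sq_nonneg (s ^ 2), sq_nonneg c]

/-- A variable speed `h` is allowed so that the same uniqueness gives the symmetries of `C`, `S`
(with `h = 1`) and the lifting of the angle along an arbitrary orbit. -/
theorem quasiTrig_unique {h : ℝ → ℝ} {M : ℝ} (hM : ∀ t, |h t| ≤ M) {c₁ s₁ c₂ s₂ : ℝ → ℝ}
    (hc₁ : ∀ t, HasDerivAt c₁ (h t * s₁ t ^ 3) t) (hs₁ : ∀ t, HasDerivAt s₁ (-(h t * c₁ t)) t)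
    (hc₂ : ∀ t, HasDerivAt c₂ (h t * s₂ t ^ 3) t) (hs₂ : ∀ t, HasDerivAt s₂ (-(h t * c₂ t)) t)
    (h₁ : ∀ t, 2 * c₁ t ^ 2 + s₁ t ^ 4 = 1) (h₂ : ∀ t, 2 * c₂ t ^ 2 + s₂ t ^ 4 = 1)
    {t₀ : ℝ} (e₁ : c₁ t₀ = c₂ t₀) (e₂ : s₁ t₀ = s₂ t₀) (t : ℝ) : c₁ t = c₂ t ∧ s₁ t = s₂ t := by
  have hsm : ContDiff ℝ 1 (fun z : ℝ × ℝ => (z.2 ^ 3, -z.1)) := by fun_prop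
  obtain ⟨K, hK⟩ := hsm.contDiffOn.exists_lipschitzOnWith (s := Metric.closedBall 0 1) one_ne_zero
    (convex_closedBall _ _) (isCompact_closedBall _ _)
  have hmem : ∀ {c s : ℝ}, 2 * c ^ 2 + s ^ 4 = 1 → (c, s) ∈ Metric.closedBall (0 : ℝ × ℝ) 1 := by
    intro c s hcs
    have := abs_le_one_of_curve hcs
    rw [mem_closedBall_zero_iff, Prod.norm_def]
    exact max_le this.1 this.2
  have := ODE_solution_unique_univ (v := fun t z => h t • ((z.2 ^ 3, -z.1) : ℝ × ℝ))
    (s := fun _ => Metric.closedBall 0 1) (K := M.toNNReal * K) (t₀ := t₀)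
    (f := fun t => (c₁ t, s₁ t)) (g := fun t => (c₂ t, s₂ t)) ?_ ?_ ?_ (by simp [e₁, e₂])
  · have h3 := congrFun this t
    exact ⟨congrArg Prod.fst h3, congrArg Prod.snd h3⟩
  · intro t
    refine LipschitzOnWith.of_dist_le_mul fun x hx y hy => ?_
    rw [dist_smul₀, NNReal.coe_mul, mul_assoc]
    refine mul_le_mul ?_ (hK.dist_le_mul x hx y hy) dist_nonneg NNReal.zero_le_coe
    exact (hM t).trans (Real.le_coe_toNNReal M)
  · intro t
    refine ⟨?_, hmem (h₁ t)⟩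
    have := (hc₁ t).prodMk (hs₁ t)
    simpa using! this
  · intro t
    refine ⟨?_, hmem (h₂ t)⟩
    have := (hc₂ t).prodMk (hs₂ t)
    simpa using! this

theorem exists_quasiTrig_solution : ∃ C S : ℝ → ℝ, C 0 = 0 ∧ S 0 = 1 ∧
    (∀ t, HasDerivAt C (S t ^ 3) t) ∧ (∀ t, HasDerivAt S (-C t) t) ∧
    ∀ t, 2 * C t ^ 2 + S t ^ 4 = 1 := by
  have hsm : ContDiff ℝ 1 (fun z : ℝ × ℝ => (z.2 ^ 3, -z.1)) := by fun_prop
  obtain ⟨γ, h0, hγ⟩ := exists_isIntegralCurve_clamp hsm (zero_le_two (α := ℝ)) (0, 1)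
  have hV : ∀ z : ℝ × ℝ, HasFDerivAt (fun z : ℝ × ℝ => 4 * (z.1 ^ 2 / 2 + z.2 ^ 4 / 4))
      (planeForm (4 * z.1) (4 * z.2 ^ 3)) z := by
    intro z
    have := (hasFDerivAt_energy z).const_mul 4
    rwa [smul_planeForm] at this
  have hsph : ∀ z : ℝ × ℝ, ‖z‖ = 2 → (8 : ℝ) ≤ 4 * (z.1 ^ 2 / 2 + z.2 ^ 4 / 4) := by
    intro z hz
    have h2 : 0 ≤ z.2 ^ 4 := by positivity
    rw [Prod.norm_def] at hz
    rcases max_choice ‖z.1‖ ‖z.2‖ with h | h <;> rw [h, Real.norm_eq_abs] at hz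
    · have : z.1 ^ 2 = 4 := by rw [← sq_abs, hz]; norm_num
      nlinarith
    · have : z.2 ^ 2 = 4 := by rw [← sq_abs, hz]; norm_num
      have h4 : z.2 ^ 4 = 16 := by rw [show z.2 ^ 4 = (z.2 ^ 2) ^ 2 by ring, this]; norm_num
      nlinarith [sq_nonneg z.1]
  have hfw : ∀ t, 0 ≤ t → ‖γ t‖ < 2 := by
    refine norm_lt_of_lyapunov hV hsph (G := fun z => ((squareClamp 2 z).2 ^ 3, -(squareClamp 2 z).1))
      ?_ (hγ.isIntegralCurveOn _) ?_ ?_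
    · intro z hz
      rw [squareClamp_eq hz, planeForm_apply]
      apply le_of_eq
      ring
    · simp [h0, Prod.norm_def]
    · norm_num [h0]
  have hbw : ∀ t, 0 ≤ t → ‖γ (-t)‖ < 2 := by
    refine norm_lt_of_lyapunov (γ := fun t => γ (-t)) hV hsph
      (G := fun z => -((squareClamp 2 z).2 ^ 3, -(squareClamp 2 z).1)) ?_ ?_ ?_ ?_
    · intro z hz
      rw [squareClamp_eq hz, planeForm_apply]
      apply le_of_eq
      simp
      ring
    · intro t _
      have := (hγ (-t)).scomp t (hasDerivAt_neg t)
      simpa using! this.hasDerivWithinAt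
    · simp [h0, Prod.norm_def]
    · norm_num [h0]
  have hb : ∀ t, ‖γ t‖ ≤ 2 := by
    intro t
    rcases le_total 0 t with h | h
    · exact (hfw t h).le
    · simpa using (hbw (-t) (by linarith)).le
  have hd : ∀ t, HasDerivAt γ ((γ t).2 ^ 3, -(γ t).1) t := by
    intro t
    have := hγ t
    simp only [squareClamp_eq (hb t)] at this
    exact this
  refine ⟨fun t => (γ t).1, fun t => (γ t).2, by simp [h0], by simp [h0], fun t => (hd t).fst,
    fun t => (hd t).snd, fun t => ?_⟩
  have hconst : ∀ t, HasDerivAt (fun t => 2 * (γ t).1 ^ 2 + (γ t).2 ^ 4) 0 t := by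
    intro t
    have h1 : HasDerivAt (fun t => (γ t).1) ((γ t).2 ^ 3) t := (hd t).fst
    have h2 : HasDerivAt (fun t => (γ t).2) (-(γ t).1) t := (hd t).snd
    have := ((h1.pow 2).const_mul 2).add (h2.pow 4)
    refine this.congr_deriv ?_
    norm_num
    ring
  have := is_const_of_deriv_eq_zero (fun t => (hconst t).differentiableAt)
    (fun t => (hconst t).deriv) t 0
  rw [this, h0]
  norm_num

theorem exists_isQuasiTrig : ∃ (C S : ℝ → ℝ) (T : ℝ), IsQuasiTrig C S T := by
  obtain ⟨C, S, hC0, hS0, hC, hS, hcurve⟩ := exists_quasiTrig_solution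
  have hCc : Continuous C := continuous_iff_continuousAt.2 fun t => (hC t).continuousAt
  have hSc : Continuous S := continuous_iff_continuousAt.2 fun t => (hS t).continuousAt
  have uniq : ∀ {c s : ℝ → ℝ}, (∀ t, HasDerivAt c (s t ^ 3) t) → (∀ t, HasDerivAt s (-c t) t) →
      (∀ t, 2 * c t ^ 2 + s t ^ 4 = 1) → ∀ {t₀ : ℝ}, c t₀ = C t₀ → s t₀ = S t₀ →
      ∀ t, c t = C t ∧ s t = S t := by
    intro c s hc hs hcs t₀ e₁ e₂ t
    exact quasiTrig_unique (h := fun _ => 1) (M := 1) (by simp) (by simpa using hc)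
      (by simpa using hs) (by simpa using hC) (by simpa using hS) hcs hcurve e₁ e₂ t
  -- If `S` stayed positive, `C` would increase, so after time 1 `S` would decrease at least at the
  -- rate `C 1 > 0` and reach zero.
  obtain ⟨t₁, ht₁, hz₁⟩ : ∃ t, 0 < t ∧ S t = 0 := by
    by_contra! hcon
    have hSpos : ∀ t, 0 ≤ t → 0 < S t := by
      intro t ht
      by_contra! hneg
      obtain ⟨r, hr, hr0⟩ := intermediate_value_Icc' ht hSc.continuousOn
        (show (0 : ℝ) ∈ Icc (S t) (S 0) from ⟨hneg, by rw [hS0]; exact zero_le_one⟩)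
      rcases hr.1.lt_or_eq with h | h
      · exact hcon r h hr0
      · rw [← h, hS0] at hr0
        exact one_ne_zero hr0
    have hmono : StrictMonoOn C (Ici 0) := by
      refine strictMonoOn_of_deriv_pos (convex_Ici 0) hCc.continuousOn fun t ht => ?_
      rw [interior_Ici] at ht
      rw [(hC t).deriv]
      exact pow_pos (hSpos t (le_of_lt ht)) 3
    have hC1 : 0 < C 1 := by
      have := hmono self_mem_Ici (show (1 : ℝ) ∈ Ici 0 from mem_Ici.2 zero_le_one)
        one_pos
      rwa [hC0] at this
    have hlin : ∀ t, 1 ≤ t → S t - S 1 ≤ -C 1 * (t - 1) := by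
      intro t ht
      refine (convex_Ici (1 : ℝ)).image_sub_le_mul_sub_of_deriv_le hSc.continuousOn
        (fun t _ => (hS t).differentiableAt.differentiableWithinAt) (fun s hs => ?_) 1
        self_mem_Ici t ht ht
      rw [interior_Ici] at hs
      have hs' : 1 < s := hs
      rw [(hS s).deriv]
      have := hmono (show (1 : ℝ) ∈ Ici 0 from mem_Ici.2 zero_le_one)
        (show s ∈ Ici 0 from zero_le_one.trans hs'.le) hs'
      linarith
    have h1 := hlin (1 + S 1 / C 1) (by have := div_pos (hSpos 1 zero_le_one) hC1; linarith)
    have h2 := hSpos (1 + S 1 / C 1) (by have := div_pos (hSpos 1 zero_le_one) hC1; linarith)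
    have h3 : -C 1 * (1 + S 1 / C 1 - 1) = -S 1 := by
      field_simp
      ring
    linarith
  obtain ⟨q, hq, hq0, hqpos⟩ : ∃ q, 0 < q ∧ S q = 0 ∧ ∀ t, 0 ≤ t → t < q → 0 < S t := by
    have hcomp : IsCompact (Icc 0 t₁ ∩ S ⁻¹' {0}) :=
      isCompact_Icc.inter_right (isClosed_singleton.preimage hSc)
    obtain ⟨q, hq, hleast⟩ := hcomp.exists_isLeast ⟨t₁, ⟨ht₁.le, le_rfl⟩, hz₁⟩
    have hq0 : S q = 0 := hq.2
    have hqpos : 0 < q := by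
      rcases hq.1.1.lt_or_eq with h | h
      · exact h
      · rw [← h, hS0] at hq0
        exact absurd hq0 one_ne_zero
    refine ⟨q, hqpos, hq0, fun t ht htq => ?_⟩
    by_contra! hneg
    obtain ⟨r, hr, hr0⟩ := intermediate_value_Icc' ht hSc.continuousOn
      (show (0 : ℝ) ∈ Icc (S t) (S 0) from ⟨hneg, by rw [hS0]; exact zero_le_one⟩)
    have := hleast ⟨⟨hr.1, hr.2.trans (htq.le.trans hq.1.2)⟩, hr0⟩
    linarith [hr.2]
  have hCmono : StrictMonoOn C (Icc 0 q) := by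
    refine strictMonoOn_of_deriv_pos (convex_Icc 0 q) hCc.continuousOn fun t ht => ?_
    rw [interior_Icc] at ht
    rw [(hC t).deriv]
    exact pow_pos (hqpos t ht.1.le ht.2) 3
  -- Symmetry of the equation in `s ↦ -s` with time reversed, about the quarter period `q`; together
  -- with the central symmetry below it yields the period `4q = 2H`.
  have hrefl : ∀ t, C (2 * q - t) = C t ∧ -S (2 * q - t) = S t := by
    have hin : ∀ t, HasDerivAt (fun t : ℝ => 2 * q - t) (-1) t := fun t =>
      (hasDerivAt_id t).const_sub (2 * q)
    refine uniq (t₀ := q) (fun t => ?_) (fun t => ?_) (fun t => ?_) ?_ ?_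
    · refine ((hC (2 * q - t)).comp t (hin t)).congr_deriv ?_
      ring
    · refine ((hS (2 * q - t)).comp t (hin t)).neg.congr_deriv ?_
      ring
    · have := hcurve (2 * q - t)
      rw [← this]
      ring
    · congr 1
      ring
    · rw [show 2 * q - q = q by ring, hq0, neg_zero]
  set H := 2 * q with hH
  have hHpos : 0 < H := by positivity
  have hCH : C H = 0 := by simpa [hC0] using (hrefl 0).1
  have hSH : S H = -1 := by
    have := (hrefl 0).2
    rw [hS0, sub_zero] at this
    linarith
  have hhalf : ∀ t, -C (t + H) = C t ∧ -S (t + H) = S t := by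
    have hin : ∀ t, HasDerivAt (fun t : ℝ => t + H) 1 t := fun t =>
      (hasDerivAt_id t).add_const H
    refine uniq (t₀ := 0) (fun t => ?_) (fun t => ?_) (fun t => ?_) ?_ ?_
    · refine ((hC (t + H)).comp t (hin t)).neg.congr_deriv ?_
      ring
    · refine ((hS (t + H)).comp t (hin t)).neg.congr_deriv ?_
      ring
    · have := hcurve (t + H)
      rw [← this]
      ring
    · rw [zero_add, hCH, hC0, neg_zero]
    · rw [zero_add, hSH, hS0, neg_neg]
  have hCpos : ∀ t, 0 < t → t < H → 0 < C t := by
    intro t ht htH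
    have key : ∀ r, 0 < r → r ≤ q → 0 < C r := fun r hr hrq => by
      have := hCmono ⟨le_refl 0, hq.le⟩ ⟨hr.le, hrq⟩ hr
      rwa [hC0] at this
    rcases le_total t q with h | h
    · exact key t ht h
    · rw [← (hrefl t).1]
      exact key _ (by linarith) (by linarith)
  have hSanti : StrictAntiOn S (Icc 0 H) := by
    refine strictAntiOn_of_deriv_neg (convex_Icc 0 H) hSc.continuousOn fun t ht => ?_
    rw [interior_Icc] at ht
    rw [(hS t).deriv]
    linarith [hCpos t ht.1 ht.2]
  have hCper : Function.Periodic C (2 * H) := fun t => by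
    have h1 := (hhalf t).1
    have h2 := (hhalf (t + H)).1
    rw [show t + 2 * H = t + H + H by ring]
    linarith
  have hSper : Function.Periodic S (2 * H) := fun t => by
    have h1 := (hhalf t).2
    have h2 := (hhalf (t + H)).2
    rw [show t + 2 * H = t + H + H by ring]
    linarith
  have hsurj : ∀ c s : ℝ, 0 ≤ c → 2 * c ^ 2 + s ^ 4 = 1 → ∃ t, C t = c ∧ S t = s := by
    intro c s hc hcs
    have hs := abs_le.1 (abs_le_one_of_curve hcs).2
    obtain ⟨t, ht, hts⟩ := intermediate_value_Icc' hHpos.le hSc.continuousOn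
      (show s ∈ Icc (S H) (S 0) by rw [hSH, hS0]; exact hs)
    refine ⟨t, ?_, hts⟩
    have h1 := hcurve t
    rw [hts] at h1
    have hnn : 0 ≤ C t := by
      rcases ht.1.lt_or_eq with h | h
      · rcases ht.2.lt_or_eq with h' | h'
        · exact (hCpos t h h').le
        · rw [h', hCH]
      · rw [← h, hC0]
    rw [← sq_eq_sq₀ hnn hc]
    linarith
  refine ⟨C, S, 2 * H, by positivity, hC, hS, hcurve, hCper, hSper, ?_, ?_⟩
  · intro a b hab hab'
    have hin : ∀ t, HasDerivAt (fun t : ℝ => t + (b - a)) 1 t := fun t =>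
      (hasDerivAt_id t).add_const (b - a)
    have h0 := uniq (c := fun t => C (t + (b - a))) (s := fun t => S (t + (b - a))) (t₀ := a)
      (fun t => ((hC (t + (b - a))).comp t (hin t)).congr_deriv (by ring))
      (fun t => ((hS (t + (b - a))).comp t (hin t)).congr_deriv (by ring))
      (fun t => hcurve _) (by simp [hab]) (by simp [hab']) 0
    simp only [zero_add, hC0, hS0] at h0
    have hT : 0 < 2 * H := by positivity
    -- By uniqueness a coincidence at `a` and `b` makes `b - a` a return time to `(0, 1)`. Its
    -- residue modulo `2H` must vanish: `S` is strictly decreasing on the first half period and `C <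
    -- 0` on the interior of the second.
    set n := ⌊(b - a) / (2 * H)⌋ with hn
    set r := (b - a) - n * (2 * H) with hr
    have hr0 : 0 ≤ r := by
      have := Int.floor_le ((b - a) / (2 * H))
      rw [le_div_iff₀ hT] at this
      linarith
    have hr1 : r < 2 * H := by
      have := Int.lt_floor_add_one ((b - a) / (2 * H))
      rw [div_lt_iff₀ hT] at this
      linarith
    have hCr : C r = 0 := by rw [hr, hCper.sub_int_mul_eq, h0.1]
    have hSr : S r = 1 := by rw [hr, hSper.sub_int_mul_eq, h0.2]
    have hrz : r = 0 := by
      by_contra hne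
      have hrpos : 0 < r := lt_of_le_of_ne hr0 (Ne.symm hne)
      rcases le_or_gt r H with h | h
      · have := hSanti ⟨le_rfl, hHpos.le⟩ ⟨hr0, h⟩ hrpos
        rw [hS0, hSr] at this
        exact lt_irrefl _ this
      · have h1 := hCpos (r - H) (by linarith) (by linarith)
        have h2 := (hhalf (r - H)).1
        rw [sub_add_cancel, hCr] at h2
        linarith
    exact ⟨n, by linarith⟩
  · intro c s hcs
    rcases le_total 0 c with h | h
    · exact hsurj c s h hcs
    · obtain ⟨t, h1, h2⟩ := hsurj (-c) (-s) (by linarith) (by rw [← hcs]; ring)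
      refine ⟨t + H, ?_, ?_⟩
      · linarith [(hhalf t).1]
      · linarith [(hhalf t).2]

end QuasiTrig

/-! ### Coefficients of the radial equation and the focal quantity. -/

section RadialAlgebra

/-- `ρ' = ρ ^ 5 * radialA m c s` for the field with `k = 1`, `s = 2` at
`(ρ ^ 2 * c, ρ * s)`. -/
def radialA (m c s : ℝ) : ℝ := m * s ^ 8 - c ^ 4

/-- The angular velocity of the field with `k = 1`, `s = 2` at `(ρ ^ 2 * c, ρ * s)` is
`ρ * (1 - ρ ^ 3 * radialB m c s)`. -/
def radialB (m c s : ℝ) : ℝ := s * c ^ 3 + 2 * m * c * s ^ 5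

/-- The derivative of `u = ρ ^ (-3)` with respect to the angle. -/
noncomputable def radialRate (m c s u : ℝ) : ℝ := -3 * radialA m c s * u / (u - radialB m c s)

/-- A primitive of `radialA (3 / 5)`. -/
noncomputable def primA (c s : ℝ) : ℝ := c ^ 3 * s + 3 / 5 * c * s ^ 5

/-- A primitive of `radialA m * radialB m`. -/
noncomputable def primAB (m s : ℝ) : ℝ :=
  s ^ 2 / 16 - (3 / 2 - 2 * m) / 24 * s ^ 6 - (3 * m - 3 / 4) / 20 * s ^ 10 -
    (m - 1 / 4) * (2 * m - 1 / 2) / 14 * s ^ 14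

/-- The polynomial factor of `cubicCorr`. -/
noncomputable def corrPoly (s : ℝ) : ℝ :=
  -77 / 12000 * s ^ 19 - 49 / 3000 * s ^ 15 + 7 / 1040 * s ^ 11 + 77 / 2600 * s ^ 7 +
    141 / 52000 * s ^ 3 + 16 / 1625 * s

/-- The derivative of `corrPoly`. -/
noncomputable def corrPolyDeriv (s : ℝ) : ℝ :=
  -1463 / 12000 * s ^ 18 - 49 / 200 * s ^ 14 + 77 / 1040 * s ^ 10 + 539 / 2600 * s ^ 6 +
    423 / 52000 * s ^ 2 + 16 / 1625

/-- The periodic correction at third order. -/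
noncomputable def cubicCorr (c s : ℝ) : ℝ := c * corrPoly s

/-- The angular derivative of `cubicCorr`. -/
noncomputable def cubicCorrDeriv (c s : ℝ) : ℝ := s ^ 3 * corrPoly s - c ^ 2 * corrPolyDeriv s

/-- The density of the third order focal quantity. -/
noncomputable def focalDensity (m c s : ℝ) : ℝ :=
  radialA m c s * radialB m c s ^ 2 - 3 * radialA m c s * primAB m s - cubicCorrDeriv c s

/-- The polynomial in `cubicCorr` is chosen so that, at `m = 3/5`, the density becomes `(32/1625)
(s² + 1/4 - (3/4) s⁴)`: positive at every point of the curve and not merely on average. -/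
theorem focalDensity_critical {c s : ℝ} (h : 2 * c ^ 2 + s ^ 4 = 1) :
    1 / 250 ≤ focalDensity (3 / 5) c s := by
  have hc : c ^ 2 = (1 - s ^ 4) / 2 := by linarith
  have hA : radialA (3 / 5) c s = 3 / 5 * s ^ 8 - (c ^ 2) ^ 2 := by unfold radialA; ring
  have hB : radialB (3 / 5) c s ^ 2 = c ^ 2 * s ^ 2 * (c ^ 2 + 6 / 5 * s ^ 4) ^ 2 := by
    unfold radialB; ring
  have key : focalDensity (3 / 5) c s = 32 / 1625 * (s ^ 2 + 1 / 4 - 3 / 4 * s ^ 4) := by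
    unfold focalDensity cubicCorrDeriv
    rw [hA, hB, hc]
    unfold primAB corrPoly corrPolyDeriv
    ring
  rw [key]
  have hs := (abs_le_one_of_curve h).2
  rw [← sq_le_one_iff_abs_le_one] at hs
  nlinarith [sq_nonneg s]

theorem exists_focalDensity_pos : ∃ η > 0, ∀ m c s : ℝ, |m - 3 / 5| < η →
    2 * c ^ 2 + s ^ 4 = 1 → 1 / 300 ≤ focalDensity m c s := by
  have hcont : Continuous fun w : ℝ × ℝ × ℝ => focalDensity w.1 w.2.1 w.2.2 := by
    unfold focalDensity radialA radialB primAB cubicCorrDeriv corrPoly corrPolyDeriv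
    fun_prop
  have hcomp : IsCompact {z : ℝ × ℝ | 2 * z.1 ^ 2 + z.2 ^ 4 = 1} := by
    refine (isCompact_closedBall (0 : ℝ × ℝ) 1).of_isClosed_subset
      (isClosed_eq (by fun_prop) continuous_const) fun z hz => ?_
    have := abs_le_one_of_curve hz
    rw [mem_closedBall_zero_iff, Prod.norm_def]
    exact max_le this.1 this.2
  have hev : ∀ᶠ m in 𝓝 (3 / 5 : ℝ), ∀ z ∈ {z : ℝ × ℝ | 2 * z.1 ^ 2 + z.2 ^ 4 = 1},
      1 / 300 < focalDensity m z.1 z.2 := by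
    refine hcomp.eventually_forall_of_forall_eventually fun z hz => ?_
    refine hcont.continuousAt.eventually (lt_mem_nhds ?_)
    exact lt_of_lt_of_le (by norm_num) (focalDensity_critical hz)
  obtain ⟨η, hη, h⟩ := Metric.eventually_nhds_iff.1 hev
  exact ⟨η, hη, fun m c s hm hcs => (h (by rwa [Real.dist_eq]) (c, s) hcs).le⟩

theorem exists_cube_bound {f : ℝ → ℝ → ℝ → ℝ}
    (hf : Continuous fun w : ℝ × ℝ × ℝ => f w.1 w.2.1 w.2.2) :
    ∃ K, ∀ m c s : ℝ, |m| ≤ 1 → |c| ≤ 1 → |s| ≤ 1 → |f m c s| ≤ K := by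
  obtain ⟨K, hK⟩ := (isCompact_closedBall (0 : ℝ × ℝ × ℝ) 1).exists_bound_of_continuousOn
    hf.continuousOn
  refine ⟨K, fun m c s hm hc hs => hK (m, c, s) ?_⟩
  rw [mem_closedBall_zero_iff, Prod.norm_def, Prod.norm_def]
  exact max_le hm (max_le hc hs)

/-- A common bound of the functions entering the radial equation. -/
structure RadialBound (K : ℝ) : Prop where
  one_le : 1 ≤ K
  abs_radialA_le : ∀ m c s : ℝ, |m| ≤ 1 → 2 * c ^ 2 + s ^ 4 = 1 → |radialA m c s| ≤ K
  abs_radialB_le : ∀ m c s : ℝ, |m| ≤ 1 → 2 * c ^ 2 + s ^ 4 = 1 → |radialB m c s| ≤ K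
  abs_primAB_le : ∀ m c s : ℝ, |m| ≤ 1 → 2 * c ^ 2 + s ^ 4 = 1 → |primAB m s| ≤ K
  abs_cubicCorr_le : ∀ c s : ℝ, 2 * c ^ 2 + s ^ 4 = 1 → |cubicCorr c s| ≤ K
  abs_cubicCorrDeriv_le : ∀ c s : ℝ, 2 * c ^ 2 + s ^ 4 = 1 → |cubicCorrDeriv c s| ≤ K

theorem exists_radialBound : ∃ K, RadialBound K := by
  obtain ⟨K₁, h₁⟩ := exists_cube_bound (f := radialA) (by unfold radialA; fun_prop)
  obtain ⟨K₂, h₂⟩ := exists_cube_bound (f := radialB) (by unfold radialB; fun_prop)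
  obtain ⟨K₃, h₃⟩ := exists_cube_bound (f := fun m _ s => primAB m s)
    (by unfold primAB; fun_prop)
  obtain ⟨K₄, h₄⟩ := exists_cube_bound (f := fun _ c s => cubicCorr c s)
    (by unfold cubicCorr corrPoly; fun_prop)
  obtain ⟨K₅, h₅⟩ := exists_cube_bound (f := fun _ c s => cubicCorrDeriv c s)
    (by unfold cubicCorrDeriv corrPoly corrPolyDeriv; fun_prop)
  have hc : ∀ {c s : ℝ}, 2 * c ^ 2 + s ^ 4 = 1 → |c| ≤ 1 := fun h => (abs_le_one_of_curve h).1
  have hs : ∀ {c s : ℝ}, 2 * c ^ 2 + s ^ 4 = 1 → |s| ≤ 1 := fun h => (abs_le_one_of_curve h).2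
  have hz : |(0 : ℝ)| ≤ 1 := by simp
  refine ⟨1 + |K₁| + |K₂| + |K₃| + |K₄| + |K₅|, ?_, ?_, ?_, ?_, ?_, ?_⟩
  · have := abs_nonneg K₁; have := abs_nonneg K₂; have := abs_nonneg K₃
    have := abs_nonneg K₄; have := abs_nonneg K₅
    linarith
  · intro m c s hm h
    have := h₁ m c s hm (hc h) (hs h)
    have := le_abs_self K₁; have := abs_nonneg K₂; have := abs_nonneg K₃
    have := abs_nonneg K₄; have := abs_nonneg K₅
    linarith
  · intro m c s hm h
    have := h₂ m c s hm (hc h) (hs h)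
    have := abs_nonneg K₁; have := le_abs_self K₂; have := abs_nonneg K₃
    have := abs_nonneg K₄; have := abs_nonneg K₅
    linarith
  · intro m c s hm h
    have := h₃ m c s hm (hc h) (hs h)
    have := abs_nonneg K₁; have := abs_nonneg K₂; have := le_abs_self K₃
    have := abs_nonneg K₄; have := abs_nonneg K₅
    linarith
  · intro c s h
    have := h₄ 0 c s hz (hc h) (hs h)
    have := abs_nonneg K₁; have := abs_nonneg K₂; have := abs_nonneg K₃
    have := le_abs_self K₄; have := abs_nonneg K₅
    linarith
  · intro c s h
    have := h₅ 0 c s hz (hc h) (hs h)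
    have := abs_nonneg K₁; have := abs_nonneg K₂; have := abs_nonneg K₃
    have := abs_nonneg K₄; have := le_abs_self K₅
    linarith

variable {c s : ℝ → ℝ} {t ω : ℝ}

theorem hasDerivAt_primA (hc : HasDerivAt c (ω * s t ^ 3) t) (hs : HasDerivAt s (-(ω * c t)) t) :
    HasDerivAt (fun t => primA (c t) (s t)) (ω * radialA (3 / 5) (c t) (s t)) t := by
  have h := ((hc.pow 3).mul hs).add ((hc.const_mul (3 / 5)).mul (hs.pow 5))
  refine h.congr_deriv ?_
  simp only [radialA, Nat.cast_ofNat, Pi.pow_apply]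
  ring

/-- On the curve `c²` is a polynomial in `s`, and `radialA * radialB` is odd in `c`, hence `c` times
a polynomial in `s`. As `S' = -C` up to the speed, it integrates to a polynomial in `S` for every
`m`. -/
theorem hasDerivAt_primAB (m : ℝ) (hs : HasDerivAt s (-(ω * c t)) t)
    (h : 2 * c t ^ 2 + s t ^ 4 = 1) :
    HasDerivAt (fun t => primAB m (s t))
      (ω * (radialA m (c t) (s t) * radialB m (c t) (s t))) t := by
  have hc : c t ^ 2 = (1 - s t ^ 4) / 2 := by linarith
  have hd := ((((hs.pow 2).div_const 16).sub ((hs.pow 6).const_mul ((3 / 2 - 2 * m) / 24))).sub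
    ((hs.pow 10).const_mul ((3 * m - 3 / 4) / 20))).sub
    ((hs.pow 14).const_mul ((m - 1 / 4) * (2 * m - 1 / 2) / 14))
  refine hd.congr_deriv ?_
  have hA : radialA m (c t) (s t) = m * s t ^ 8 - (c t ^ 2) ^ 2 := by unfold radialA; ring
  have hB : radialB m (c t) (s t) = c t * s t * (c t ^ 2 + 2 * m * s t ^ 4) := by
    unfold radialB; ring
  rw [hA, hB, hc]
  norm_num
  ring

theorem hasDerivAt_cubicCorr (hc : HasDerivAt c (ω * s t ^ 3) t)
    (hs : HasDerivAt s (-(ω * c t)) t) :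
    HasDerivAt (fun t => cubicCorr (c t) (s t)) (ω * cubicCorrDeriv (c t) (s t)) t := by
  have hp : HasDerivAt corrPoly (corrPolyDeriv (s t)) (s t) := by
    have hi := hasDerivAt_id (s t)
    have := ((((((hi.pow 19).const_mul (-77 / 12000)).sub ((hi.pow 15).const_mul (49 / 3000))).add
      ((hi.pow 11).const_mul (7 / 1040))).add ((hi.pow 7).const_mul (77 / 2600))).add
      ((hi.pow 3).const_mul (141 / 52000))).add (hi.const_mul (16 / 1625))
    refine this.congr_deriv ?_
    simp only [corrPolyDeriv, id]
    norm_num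
    ring
  have := hc.mul (hp.comp t hs)
  refine this.congr_deriv ?_
  simp only [cubicCorrDeriv, Function.comp]
  ring

end RadialAlgebra

/-! ### The radial equation and the displacement after one turn. -/

section RadialEquation

theorem radialRate_eq {m c s u : ℝ} (h : u - radialB m c s ≠ 0) : radialRate m c s u =
    -3 * radialA m c s - 3 * radialA m c s * radialB m c s * (u - radialB m c s)⁻¹ := by
  unfold radialRate
  field_simp
  ring

namespace RadialBound

variable {K m c s u v : ℝ}

theorem one_le_sub (hK : RadialBound K) (hm : |m| ≤ 1) (h : 2 * c ^ 2 + s ^ 4 = 1)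
    (hu : K + 1 ≤ u) : 1 ≤ u - radialB m c s := by
  have := (abs_le.1 (hK.abs_radialB_le m c s hm h)).2
  linarith

theorem abs_radialRate_le (hK : RadialBound K) (hm : |m| ≤ 1) (h : 2 * c ^ 2 + s ^ 4 = 1)
    (hu : K + 1 ≤ u) : |radialRate m c s u| ≤ 6 * K ^ 2 := by
  have h1 := hK.one_le_sub hm h hu
  have hA := hK.abs_radialA_le m c s hm h
  have hB := hK.abs_radialB_le m c s hm h
  have hK1 := hK.one_le
  rw [radialRate_eq (by linarith)]
  have h2 : |(u - radialB m c s)⁻¹| ≤ 1 := by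
    rw [abs_of_nonneg (by positivity)]
    exact inv_le_one_of_one_le₀ h1
  have h3 : |3 * radialA m c s * radialB m c s * (u - radialB m c s)⁻¹| ≤ 3 * K * K * 1 := by
    rw [abs_mul, abs_mul, abs_mul, abs_of_pos (by norm_num : (0 : ℝ) < 3)]
    gcongr
  have h4 : |-3 * radialA m c s| ≤ 3 * K := by
    rw [abs_mul, abs_neg, abs_of_pos (by norm_num : (0 : ℝ) < 3)]
    gcongr
  refine (abs_sub _ _).trans ?_
  nlinarith

theorem abs_radialRate_sub_le (hK : RadialBound K) (hm : |m| ≤ 1) (h : 2 * c ^ 2 + s ^ 4 = 1)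
    (hu : K + 1 ≤ u) (hv : K + 1 ≤ v) :
    |radialRate m c s u - radialRate m c s v| ≤ 3 * K ^ 2 * |u - v| := by
  have h1 := hK.one_le_sub hm h hu
  have h2 := hK.one_le_sub hm h hv
  have hA := hK.abs_radialA_le m c s hm h
  have hB := hK.abs_radialB_le m c s hm h
  have hK1 := hK.one_le
  rw [radialRate_eq (by linarith), radialRate_eq (by linarith)]
  have h3 : -3 * radialA m c s - 3 * radialA m c s * radialB m c s * (u - radialB m c s)⁻¹ -
      (-3 * radialA m c s - 3 * radialA m c s * radialB m c s * (v - radialB m c s)⁻¹) =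
      3 * radialA m c s * radialB m c s * (u - v) *
        ((u - radialB m c s)⁻¹ * (v - radialB m c s)⁻¹) := by
    field_simp
    ring
  have h4 : |(u - radialB m c s)⁻¹ * (v - radialB m c s)⁻¹| ≤ 1 := by
    rw [abs_of_nonneg (by positivity)]
    exact mul_le_one₀ (inv_le_one_of_one_le₀ h1) (by positivity) (inv_le_one_of_one_le₀ h2)
  rw [h3, abs_mul, abs_mul, abs_mul, abs_mul, abs_of_pos (by norm_num : (0 : ℝ) < 3)]
  calc 3 * |radialA m c s| * |radialB m c s| * |u - v| *
        |(u - radialB m c s)⁻¹ * (v - radialB m c s)⁻¹|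
      ≤ 3 * K * K * |u - v| * 1 := by gcongr
    _ = 3 * K ^ 2 * |u - v| := by ring

end RadialBound

variable {C S : ℝ → ℝ} {T K m : ℝ}

theorem IsQuasiTrig.continuous_fst (hq : IsQuasiTrig C S T) : Continuous C :=
  continuous_iff_continuousAt.2 fun t => (hq.hasDerivAt_fst t).continuousAt

theorem IsQuasiTrig.continuous_snd (hq : IsQuasiTrig C S T) : Continuous S :=
  continuous_iff_continuousAt.2 fun t => (hq.hasDerivAt_snd t).continuousAt

/-- Monotonicity of `u + 3G/u + 3J/u²` for large `u`: it turns the decrease of the corrected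
quantity over one turn into a decrease of `u` itself. -/
theorem add_div_le_of_le {K U x y G J : ℝ} (hK1 : 1 ≤ K) (hU : 6300 * K ^ 2 ≤ U) (hUx : U ≤ x)
    (hxy' : x ≤ y) (hbG : |G| ≤ K) (hbJ : |J| ≤ K) :
    x + 3 * G / x + 3 * J / x ^ 2 ≤ y + 3 * G / y + 3 * J / y ^ 2 := by
  have hU1 : 6300 ≤ U := by nlinarith
  have hU12' : 12 * K ≤ U := by nlinarith
  have hx : 0 < x := by linarith
  have hy : 0 < y := by linarith
  have h1 : 3 * G / x - 3 * G / y ≤ (1 / 2) * (y - x) := by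
    have : 3 * G / x - 3 * G / y = 3 * G / (x * y) * (y - x) := by field_simp
    rw [this]
    refine mul_le_mul_of_nonneg_right ?_ (by linarith)
    rw [div_le_iff₀ (by positivity)]
    have := (abs_le.1 hbG).2
    have hU'' : 0 ≤ U := by linarith
    have hUy : U ≤ y := hUx.trans hxy'
    have hxy : U * U ≤ x * y := by gcongr
    nlinarith
  have h2 : 3 * J / x ^ 2 - 3 * J / y ^ 2 ≤ (1 / 2) * (y - x) := by
    have : 3 * J / x ^ 2 - 3 * J / y ^ 2 = 3 * J * (1 / (x ^ 2 * y) + 1 / (x * y ^ 2)) * (y - x) := by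
      field_simp
      ring
    rw [this]
    refine mul_le_mul_of_nonneg_right ?_ (by linarith)
    have hx1 : 1 ≤ x := by linarith
    have hy1 : 1 ≤ y := by linarith
    have hU12 := hU12'
    have i1 : 1 / (x ^ 2 * y) ≤ 1 / U := by
      apply one_div_le_one_div_of_le (by linarith)
      calc U ≤ x := hUx
        _ ≤ x * (x * y) := le_mul_of_one_le_right hx.le (one_le_mul_of_one_le_of_one_le hx1 hy1)
        _ = x ^ 2 * y := by ring
    have i2 : 1 / (x * y ^ 2) ≤ 1 / U := by
      apply one_div_le_one_div_of_le (by linarith)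
      calc U ≤ y := hUx.trans hxy'
        _ ≤ y * (x * y) := le_mul_of_one_le_right hy.le (one_le_mul_of_one_le_of_one_le hx1 hy1)
        _ = x * y ^ 2 := by ring
    have hU' : 0 < U := by linarith
    have hp : 0 ≤ 1 / (x ^ 2 * y) + 1 / (x * y ^ 2) := by positivity
    calc 3 * J * (1 / (x ^ 2 * y) + 1 / (x * y ^ 2))
        ≤ 3 * K * (1 / (x ^ 2 * y) + 1 / (x * y ^ 2)) := by
          have := (abs_le.1 hbJ).2
          gcongr
      _ ≤ 3 * K * (1 / U + 1 / U) := by gcongr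
      _ = 6 * K / U := by ring
      _ ≤ 1 / 2 := by
          rw [div_le_iff₀ hU']
          linarith
  linarith

/-- Along a solution of the radial equation with parameter close to `3 / 5`, the inverse radius
decreases after one turn unless it is large compared with the distance to `3 / 5`. -/
theorem radial_return_lt (hq : IsQuasiTrig C S T) (hK : RadialBound K) (hm : |m| ≤ 1)
    (hm' : m < 3 / 5) (hf : ∀ c s : ℝ, 2 * c ^ 2 + s ^ 4 = 1 → 1 / 300 ≤ focalDensity m c s)
    {U V : ℝ} (hU : 6300 * K ^ 2 ≤ U) (hV : (3 / 5 - m) * (900 * V ^ 2) < 1) {u : ℝ → ℝ}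
    (hu : ∀ t ∈ Icc 0 T, HasDerivAt u (radialRate m (C t) (S t) (u t)) t)
    (hUu : ∀ t ∈ Icc 0 T, U ≤ u t) (huV : ∀ t ∈ Icc 0 T, u t ≤ V) : u T < u 0 := by
  have hK1 := hK.one_le
  set μ := 3 / 5 - m with hμ
  have hμ0 : 0 < μ := by linarith
  have hU1 : K + 1 ≤ U := by nlinarith
  -- Successive primitives cancel the orders 1 and `1/u` of `u'`, up to the term `3 μ S^8` from `m ≠
  -- 3/5`. Differentiating `3 primAB / u` produces the `-3 A G` of the focal density.
  set Ψ : ℝ → ℝ := fun t => u t + 3 * primA (C t) (S t) + 3 * primAB m (S t) / u t +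
    3 * cubicCorr (C t) (S t) / u t ^ 2 with hΨ
  have hd : ∀ t ∈ Icc 0 T, ∃ d < 0, HasDerivAt Ψ d t := by
    intro t ht
    have hcs := hq.curve t
    have hut : U ≤ u t := hUu t ht
    have hu0 : 0 < u t := by linarith
    have hX := hK.one_le_sub hm hcs (hU1.trans hut)
    have hc : HasDerivAt C (1 * S t ^ 3) t := by simpa using hq.hasDerivAt_fst t
    have hs : HasDerivAt S (-(1 * C t)) t := by simpa using hq.hasDerivAt_snd t
    have h1 := hasDerivAt_primA hc hs
    have h2 := hasDerivAt_primAB m hs hcs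
    have h3 := hasDerivAt_cubicCorr hc hs
    have h4 := hu t ht
    have h := ((h4.add (h1.const_mul 3)).add ((h2.const_mul 3).div h4 hu0.ne')).add
      ((h3.const_mul 3).div (h4.pow 2) (pow_pos hu0 2).ne')
    refine ⟨_, ?_, h⟩
    have hfd := hf _ _ hcs
    have hbA := hK.abs_radialA_le m _ _ hm hcs
    have hbB := hK.abs_radialB_le m _ _ hm hcs
    have hbJ := hK.abs_cubicCorr_le _ _ hcs
    have hbJ' := hK.abs_cubicCorrDeriv_le _ _ hcs
    have hA0 : radialA (3 / 5) (C t) (S t) = radialA m (C t) (S t) + μ * S t ^ 8 := by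
      rw [hμ]; unfold radialA; ring
    have hS1 := (abs_le_one_of_curve hcs).2
    have hS8 : S t ^ 8 ≤ 1 := by
      rw [← Even.pow_abs (by decide : Even 8)]
      exact pow_le_one₀ (abs_nonneg _) hS1
    have hS80 : 0 ≤ S t ^ 8 := Even.pow_nonneg (by decide) _
    rw [hA0]
    unfold focalDensity at hfd
    unfold radialRate
    generalize radialA m (C t) (S t) = A at *
    generalize radialB m (C t) (S t) = B at *
    generalize cubicCorr (C t) (S t) = J at *
    generalize cubicCorrDeriv (C t) (S t) = J' at *
    generalize primAB m (S t) = G at *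
    generalize S t ^ 8 = σ at *
    have huV' := huV t ht
    simp only [Pi.pow_apply]
    generalize u t = w at *
    have hXpos : 0 < w - B := by linarith
    -- The focal term is at most `-1/(100 w²)`. Of this, `1/(300 w²)` absorbs the cubic remainder,
    -- bounded by `21 K²/w³` (hence `6300 = 300 · 21`), and `1/(150 w²)` absorbs the drift, at most
    -- `6μ` (hence `900 = 6 · 150`).
    have e : ∀ Z : ℝ, Z = (w / (w - B)) * ((3 * μ * σ * (w - B) / w) -
        3 * (A * B ^ 2 - 3 * A * G - J') / w ^ 2 + (18 * J * A - 3 * J' * B) / w ^ 3) →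
        Z < 0 := by
      rintro Z rfl
      refine mul_neg_of_pos_of_neg (by positivity) ?_
      have b1 : 3 * μ * σ * (w - B) / w ≤ 6 * μ := by
        rw [div_le_iff₀ hu0]
        have hB' := (abs_le.1 hbB).1
        have : w - B ≤ 2 * w := by linarith
        have : 3 * μ * σ * (w - B) ≤ 3 * μ * 1 * (2 * w) := by gcongr
        linarith
      have b2 : (18 * J * A - 3 * J' * B) / w ^ 3 ≤ 1 / 300 / w ^ 2 := by
        rw [div_le_div_iff₀ (by positivity) (by positivity)]
        have hJA : J * A ≤ K * K := (le_abs_self _).trans (by rw [abs_mul]; gcongr)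
        have hJB : -(J' * B) ≤ K * K := (neg_le_abs _).trans (by rw [abs_mul]; gcongr)
        have : 18 * J * A - 3 * J' * B ≤ 1 / 300 * w := by nlinarith
        calc _ ≤ 1 / 300 * w * w ^ 2 := by gcongr
          _ = _ := by ring
      have b3 : 1 / 100 / w ^ 2 ≤ 3 * (A * B ^ 2 - 3 * A * G - J') / w ^ 2 := by
        gcongr
        linarith
      have b4 : 6 * μ < 1 / 150 / w ^ 2 := by
        rw [lt_div_iff₀ (by positivity)]
        have : w ^ 2 ≤ V ^ 2 := by gcongr
        nlinarith
      have b5 : 1 / 100 / w ^ 2 = 1 / 150 / w ^ 2 + 1 / 300 / w ^ 2 := by ring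
      linarith
    apply e
    have hw : w ≠ 0 := hu0.ne'
    have hwB : w - B ≠ 0 := hXpos.ne'
    field_simp
    ring
  have hanti : StrictAntiOn Ψ (Icc 0 T) := by
    refine strictAntiOn_of_deriv_neg (convex_Icc 0 T) ?_ ?_
    · intro t ht
      obtain ⟨d, -, hd'⟩ := hd t ht
      exact hd'.continuousAt.continuousWithinAt
    · intro t ht
      obtain ⟨d, hneg, hd'⟩ := hd t (interior_subset ht)
      rwa [hd'.deriv]
  have h0T : (0 : ℝ) ∈ Icc 0 T := ⟨le_rfl, hq.pos.le⟩
  have hTT : T ∈ Icc 0 T := ⟨hq.pos.le, le_rfl⟩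
  have hlt := hanti h0T hTT hq.pos
  have hCT : C T = C 0 := by simpa using hq.periodic_fst 0
  have hST : S T = S 0 := by simpa using hq.periodic_snd 0
  simp only [hΨ, hCT, hST] at hlt
  by_contra! hcon
  have hbG := hK.abs_primAB_le m _ _ hm (hq.curve 0)
  have hbJ := hK.abs_cubicCorr_le _ _ (hq.curve 0)
  have hU0 := hUu 0 h0T
  have hUT := hUu T hTT
  generalize primAB m (S 0) = G at *
  generalize cubicCorr (C 0) (S 0) = J at *
  generalize u 0 = x at *
  generalize u T = y at *
  exact hlt.not_ge (by linarith [add_div_le_of_le hK1 hU hU0 hcon hbG hbJ])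

/-- Along a solution of the radial equation, the inverse radius increases after one turn if it is
large compared with the inverse distance of the parameter to `3 / 5`. -/
theorem radial_return_gt (hq : IsQuasiTrig C S T) (hK : RadialBound K) (hm : |m| ≤ 1)
    (hm' : m < 3 / 5) {U : ℝ} (hU : K + 1 ≤ U) (hUm : 64 * K ^ 2 ≤ (3 / 5 - m) * U) {u : ℝ → ℝ}
    (hu : ∀ t ∈ Icc 0 T, HasDerivAt u (radialRate m (C t) (S t) (u t)) t)
    (hUu : ∀ t ∈ Icc 0 T, U ≤ u t) : u 0 < u T := by
  have hK1 := hK.one_le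
  set μ := 3 / 5 - m with hμ
  have hμ0 : 0 < μ := by linarith
  have hμ2 : μ ≤ 2 := by
    have := (abs_le.1 hm).1
    linarith
  -- The drift `3 μ S^8` vanishes at some angles. As `(C S)' = S⁴ - C²`, the last term turns it into
  -- `3 μ (S^8 + (C² - S⁴)/2)`, whose bracket equals `(s⁴ - 3/8)² + 7/64` on the curve.
  set Ψ : ℝ → ℝ := fun t => u t + 3 * primA (C t) (S t) + -(3 * μ / 2) * (C t * S t) with hΨ
  have hd : ∀ t ∈ Icc 0 T, ∃ d > 0, HasDerivAt Ψ d t := by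
    intro t ht
    have hcs := hq.curve t
    have hut : U ≤ u t := hUu t ht
    have hu0 : 0 < u t := by linarith
    have hX := hK.one_le_sub hm hcs (hU.trans hut)
    have hc : HasDerivAt C (1 * S t ^ 3) t := by simpa using hq.hasDerivAt_fst t
    have hs : HasDerivAt S (-(1 * C t)) t := by simpa using hq.hasDerivAt_snd t
    have h1 := hasDerivAt_primA hc hs
    have h4 := hu t ht
    have h := (h4.add (h1.const_mul 3)).add ((hc.mul hs).const_mul (-(3 * μ / 2)))
    refine ⟨_, ?_, h⟩
    have hbA := hK.abs_radialA_le (3 / 5) _ _ (by norm_num [abs_of_pos]) hcs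
    have hbB := hK.abs_radialB_le m _ _ hm hcs
    have hA0 : radialA m (C t) (S t) = radialA (3 / 5) (C t) (S t) - μ * S t ^ 8 := by
      rw [hμ]; unfold radialA; ring
    unfold radialRate
    rw [hA0]
    generalize radialA (3 / 5) (C t) (S t) = A at *
    generalize radialB m (C t) (S t) = B at *
    generalize u t = w at *
    generalize C t = c at *
    generalize S t = s at *
    have hXpos : 0 < w - B := by linarith
    have e : ∀ Z : ℝ, Z = (w / (w - B)) * (3 * μ * (s ^ 8 + (c ^ 2 - s ^ 4) / 2) -
        B * (3 * A - 3 * μ / 2 * (s ^ 4 - c ^ 2)) / w) → Z > 0 := by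
      rintro Z rfl
      refine mul_pos (by positivity) ?_
      have b1 : 7 / 64 ≤ s ^ 8 + (c ^ 2 - s ^ 4) / 2 := by
        have : c ^ 2 = (1 - s ^ 4) / 2 := by linarith
        rw [this]
        nlinarith [sq_nonneg (s ^ 4 - 3 / 8)]
      have b2 : B * (3 * A - 3 * μ / 2 * (s ^ 4 - c ^ 2)) / w ≤ 6 * μ / 64 := by
        rw [div_le_iff₀ hu0]
        have hsc : |s ^ 4 - c ^ 2| ≤ 1 := by
          have i1 : 0 ≤ s ^ 4 := by positivity
          rw [abs_le]
          constructor <;> nlinarith [sq_nonneg c]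
        have i2 : |3 * A - 3 * μ / 2 * (s ^ 4 - c ^ 2)| ≤ 3 * K + 3 := by
          refine (abs_sub _ _).trans ?_
          rw [abs_mul, abs_mul, abs_of_pos (by positivity : (0 : ℝ) < 3 * μ / 2),
            abs_of_pos (by norm_num : (0 : ℝ) < 3)]
          have : 3 * μ / 2 * |s ^ 4 - c ^ 2| ≤ 3 * μ / 2 * 1 := by gcongr
          linarith
        have i3 : B * (3 * A - 3 * μ / 2 * (s ^ 4 - c ^ 2)) ≤ K * (3 * K + 3) := by
          refine (le_abs_self _).trans ?_
          rw [abs_mul]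
          gcongr
        have i4 : μ * U ≤ μ * w := by gcongr
        nlinarith
      have b3 := mul_le_mul_of_nonneg_left b1 hμ0.le
      nlinarith
    apply e
    have hw : w ≠ 0 := hu0.ne'
    have hwB : w - B ≠ 0 := hXpos.ne'
    field_simp
    ring
  have hmono : StrictMonoOn Ψ (Icc 0 T) := by
    refine strictMonoOn_of_deriv_pos (convex_Icc 0 T) ?_ ?_
    · intro t ht
      obtain ⟨d, -, hd'⟩ := hd t ht
      exact hd'.continuousAt.continuousWithinAt
    · intro t ht
      obtain ⟨d, hpos, hd'⟩ := hd t (interior_subset ht)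
      rwa [hd'.deriv]
  have hlt := hmono ⟨le_rfl, hq.pos.le⟩ ⟨hq.pos.le, le_rfl⟩ hq.pos
  have hCT : C T = C 0 := by simpa using hq.periodic_fst 0
  have hST : S T = S 0 := by simpa using hq.periodic_snd 0
  simp only [hΨ, hCT, hST] at hlt
  linarith

end RadialEquation

/-! ### A fixed point of the return map. -/

section RadialPeriodic

variable {C S : ℝ → ℝ} {T K m : ℝ}

theorem continuous_radialRate (hK : RadialBound K) (hm : |m| ≤ 1) {c s u : ℝ → ℝ}
    (hc : Continuous c) (hs : Continuous s) (hu : Continuous u)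
    (hcs : ∀ t, 2 * c t ^ 2 + s t ^ 4 = 1) (hKu : ∀ t, K + 1 ≤ u t) :
    Continuous fun t => radialRate m (c t) (s t) (u t) := by
  have hne : ∀ t, u t - radialB m (c t) (s t) ≠ 0 := fun t => by
    have := hK.one_le_sub hm (hcs t) (hKu t)
    linarith
  unfold radialRate
  refine Continuous.div ?_ ?_ hne
  · unfold radialA
    fun_prop
  · unfold radialB
    fun_prop

-- Replacing `u` by `max U u` keeps away from the singularity `u = B` and makes the equation bounded
-- and Lipschitz, hence with a continuous time-`T` map; solutions staying above `U` are genuine.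
open scoped NNReal in
theorem exists_clamped_radial_flow (hq : IsQuasiTrig C S T) (hK : RadialBound K) (hm : |m| ≤ 1)
    {U : ℝ} (hU : K + 1 ≤ U) : ∃ φ : ℝ → ℝ → ℝ, (∀ x, φ x 0 = x) ∧
      (∀ x t, HasDerivAt (φ x) (radialRate m (C t) (S t) (max U (φ x t))) t) ∧
      (∀ x t, 0 ≤ t → |φ x t - x| ≤ 6 * K ^ 2 * t) ∧ (Continuous fun x => φ x T) ∧
      ∀ x, φ x T = x → Function.Periodic (φ x) T := by
  set v : ℝ → ℝ → ℝ := fun t u => radialRate m (C t) (S t) (max U u) with hv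
  have hmax : ∀ u, K + 1 ≤ max U u := fun u => hU.trans (le_max_left _ _)
  have hK2 : 0 ≤ K ^ 2 := sq_nonneg K
  have hL : ∀ t, LipschitzWith (3 * K ^ 2).toNNReal (v t) := by
    intro t
    refine LipschitzWith.of_dist_le_mul fun x y => ?_
    rw [Real.coe_toNNReal _ (by positivity), Real.dist_eq, Real.dist_eq]
    refine (hK.abs_radialRate_sub_le hm (hq.curve t) (hmax x) (hmax y)).trans ?_
    refine mul_le_mul_of_nonneg_left ?_ (by positivity)
    refine (abs_max_sub_max_le_max U x U y).trans ?_
    rw [sub_self, abs_zero, max_eq_right (abs_nonneg _)]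
  have hc : ∀ x, Continuous fun t => v t x := fun x =>
    continuous_radialRate hK hm hq.continuous_fst hq.continuous_snd continuous_const hq.curve
      fun _ => hmax x
  have hb : ∀ t x, |v t x| ≤ 6 * K ^ 2 := fun t x =>
    hK.abs_radialRate_le hm (hq.curve t) (hmax x)
  have hex := fun x₀ : ℝ => exists_isIntegralCurve_of_bounded_lipschitz (M := (6 * K ^ 2).toNNReal)
    hL hc (fun t x => by rw [Real.coe_toNNReal _ (by positivity)]; exact hb t x) x₀
  choose φ h0 hφ using hex
  have hφ' : ∀ x t, HasDerivAt (φ x) (v t (φ x t)) t := fun x t => hφ x t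
  refine ⟨φ, h0, hφ', ?_, ?_, ?_⟩
  · intro x t ht
    have := (convex_univ (𝕜 := ℝ) (E := ℝ)).norm_image_sub_le_of_norm_hasDerivWithin_le
      (f := φ x) (f' := fun t => v t (φ x t)) (C := 6 * K ^ 2)
      (fun s _ => (hφ' x s).hasDerivWithinAt) (fun s _ => hb s _) (mem_univ 0) (mem_univ t)
    simpa [h0, abs_of_nonneg ht] using this
  · have : LipschitzWith (Real.exp ((3 * K ^ 2).toNNReal * (T - 0))).toNNReal fun x => φ x T := by
      refine LipschitzWith.of_dist_le_mul fun x y => ?_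
      rw [Real.coe_toNNReal _ (Real.exp_pos _).le]
      have := dist_le_of_trajectories_ODE (a := 0) (b := T) (f := φ x) (g := φ y)
        (δ := dist x y) hL
        (fun t _ => (hφ' x t).continuousAt.continuousWithinAt)
        (fun t _ => (hφ' x t).hasDerivWithinAt)
        (fun t _ => (hφ' y t).continuousAt.continuousWithinAt)
        (fun t _ => (hφ' y t).hasDerivWithinAt) (by rw [h0, h0]) T ⟨hq.pos.le, le_rfl⟩
      rwa [mul_comm]
    exact this.continuous
  · intro x hx
    have hin : ∀ t, HasDerivAt (fun t : ℝ => t + T) 1 t := fun t =>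
      (hasDerivAt_id t).add_const T
    have := ODE_solution_unique_univ (v := v) (s := fun _ => univ) (t₀ := 0)
      (f := fun t => φ x (t + T)) (g := φ x) (fun t => (hL t).lipschitzOnWith)
      (fun t => ⟨?_, mem_univ _⟩) (fun t => ⟨hφ' x t, mem_univ _⟩) (by simp [h0, hx])
    · exact fun t => congrFun this t
    · have h1 := (hφ' x (t + T)).comp t (hin t)
      refine h1.congr_deriv ?_
      simp only [hv]
      rw [hq.periodic_fst t, hq.periodic_snd t, mul_one]

theorem exists_periodic_radial_solution (hq : IsQuasiTrig C S T) (hK : RadialBound K) :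
    ∃ U₁ : ℝ, ∀ U, U₁ ≤ U → ∃ η > 0, ∀ m, 3 / 5 - η < m → m < 3 / 5 → ∃ v : ℝ → ℝ,
      Function.Periodic v T ∧ (∀ t, U ≤ v t) ∧
        ∀ t, HasDerivAt v (radialRate m (C t) (S t) (v t)) t := by
  obtain ⟨η₀, hη₀, hfoc⟩ := exists_focalDensity_pos
  have hK1 := hK.one_le
  have hT := hq.pos
  refine ⟨6300 * K ^ 2, fun U hU => ?_⟩
  have hU1 : K + 1 ≤ U := by nlinarith
  have hU0 : 0 < U := by linarith
  set D := 6 * K ^ 2 * T with hD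
  have hD0 : 0 ≤ D := by positivity
  set b := U + D with hb
  set V := U + 2 * D with hV
  have hV0 : 0 < V := by positivity
  refine ⟨min (min η₀ (1 / (1000 * V ^ 2))) 1, by positivity, fun m hm1 hm2 => ?_⟩
  have g1 : 3 / 5 - m < η₀ := by
    have := (min_le_left _ _).trans (min_le_left η₀ (1 / (1000 * V ^ 2))) (a := min (min η₀ (1 / (1000 * V ^ 2))) 1)
    linarith
  have g2 : 3 / 5 - m < 1 / (1000 * V ^ 2) := by
    have := (min_le_left _ _).trans (min_le_right η₀ (1 / (1000 * V ^ 2))) (a := min (min η₀ (1 / (1000 * V ^ 2))) 1)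
    linarith
  have g3 : 3 / 5 - m < 1 := by
    have := min_le_right (min η₀ (1 / (1000 * V ^ 2))) 1
    linarith
  have hm : |m| ≤ 1 := by
    rw [abs_le]
    constructor <;> linarith
  set μ := 3 / 5 - m with hμ
  have hμ0 : 0 < μ := by linarith
  obtain ⟨φ, h0, hd, hbd, hcont, hper⟩ := exists_clamped_radial_flow hq hK hm hU1
  have hrange : ∀ x, b ≤ x → ∀ t ∈ Icc 0 T, x - D ≤ φ x t ∧ φ x t ≤ x + D := by
    intro x hx t ht
    have h1 := abs_le.1 (hbd x t ht.1)
    have h2 : 6 * K ^ 2 * t ≤ D := by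
      rw [hD]
      have := ht.2
      gcongr
    constructor <;> linarith [h1.1, h1.2]
  have hd' : ∀ x, b ≤ x → ∀ t ∈ Icc 0 T,
      HasDerivAt (φ x) (radialRate m (C t) (S t) (φ x t)) t := by
    intro x hx t ht
    have h1 := hd x t
    rwa [max_eq_right] at h1
    linarith [(hrange x hx t ht).1]
  -- Over a turn `u` moves by at most `D`. Starting from `b = U + D` it stays in `[U, V]`, where the
  -- focal term wins; from `a` it stays above `64 K²/μ`, where the drift wins.
  set a := b + D + 64 * K ^ 2 / μ with ha
  have ha' : 0 ≤ 64 * K ^ 2 / μ := by positivity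
  have hba : b ≤ a := by linarith
  have hlow : φ b T ≤ b := by
    have := radial_return_lt hq hK hm hm2 (fun c s hcs => hfoc m c s ?_ hcs) (U := U) (V := V)
      (by linarith) ?_ (hd' b le_rfl) (fun t ht => ?_) (fun t ht => ?_)
    · rw [h0] at this
      exact this.le
    · rw [abs_sub_comm, abs_of_pos hμ0]
      exact g1
    · rw [lt_div_iff₀ (by positivity)] at g2
      nlinarith [sq_nonneg V]
    · linarith [(hrange b le_rfl t ht).1]
    · linarith [(hrange b le_rfl t ht).2]
  have hhigh : a ≤ φ a T := by
    have := radial_return_gt hq hK hm hm2 (U := b + 64 * K ^ 2 / μ) (by linarith) ?_ (hd' a hba)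
      (fun t ht => ?_)
    · rw [h0] at this
      exact this.le
    · have : μ * (b + 64 * K ^ 2 / μ) = μ * b + 64 * K ^ 2 := by field_simp
      rw [← hμ, this]
      have : 0 ≤ μ * b := by positivity
      linarith
    · linarith [(hrange a hba t ht).1]
  obtain ⟨x, hx, hfix⟩ := intermediate_value_Icc hba
    (f := fun x => φ x T - x) (hcont.sub continuous_id).continuousOn
    (show (0 : ℝ) ∈ Icc (φ b T - b) (φ a T - a) from ⟨by linarith, by linarith⟩)
  have hpx := hper x (by simpa [sub_eq_zero] using hfix)
  have hUx : ∀ t, U ≤ φ x t := by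
    intro t
    obtain ⟨r, hr, hr'⟩ := hpx.exists_mem_Ico₀ hT t
    rw [hr']
    linarith [(hrange x hx.1 r (Ico_subset_Icc_self hr)).1, hx.1]
  refine ⟨φ x, hpx, hUx, fun t => ?_⟩
  have h1 := hd x t
  rwa [max_eq_right (hUx t)] at h1

end RadialPeriodic

/-! ### Passage between radial solutions and orbits in the plane. -/

section Orbits

theorem surjective_of_hasDerivAt_ge {g θ : ℝ → ℝ} {c : ℝ} (hd : ∀ x, HasDerivAt θ (g x) x)
    (hc : 0 < c) (hcg : ∀ t, c ≤ g t) : Function.Surjective θ := by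
  have hcont : Continuous θ := continuous_iff_continuousAt.2 fun x => (hd x).continuousAt
  have hlin : Monotone fun x => θ x - c * x := by
    refine monotone_of_deriv_nonneg (fun x => ?_) (fun x => ?_)
    · exact ((hd x).sub ((hasDerivAt_id x).const_mul c)).differentiableAt
    · have := (hd x).sub ((hasDerivAt_id x).const_mul c)
      erw [this.deriv]
      linarith [hcg x]
  have htop : Tendsto θ atTop atTop := by
    refine tendsto_atTop_mono' _ ?_
      (tendsto_atTop_add_const_left _ (θ 0) (tendsto_id.const_mul_atTop hc))
    filter_upwards [eventually_ge_atTop 0] with x hx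
    have := hlin hx
    simp only [mul_zero, sub_zero] at this
    simp only [id]
    linarith
  have hbot : Tendsto θ atBot atBot := by
    refine tendsto_atBot_mono' _ ?_
      (tendsto_atBot_add_const_left _ (θ 0) (tendsto_id.const_mul_atBot hc))
    filter_upwards [eventually_le_atBot 0] with x hx
    have := hlin hx
    simp only [mul_zero, sub_zero] at this
    simp only [id]
    linarith
  exact hcont.surjective htop hbot

/-- Here `g` is time per unit angle: its integral is elapsed time as a function of the angle, and
`σ`, the inverse function, is the angle as a function of time. -/
theorem exists_time_change {g : ℝ → ℝ} {T c : ℝ} (hg : Continuous g) (hc : 0 < c)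
    (hcg : ∀ t, c ≤ g t) (hT : 0 < T) (hper : Function.Periodic g T) :
    ∃ σ : ℝ → ℝ, Function.Surjective σ ∧ (∀ t, HasDerivAt σ (g (σ t))⁻¹ t) ∧
      ∃ P > 0, ∀ t, σ (t + P) = σ t + T := by
  set θ : ℝ → ℝ := fun x => ∫ y in (0 : ℝ)..x, g y with hθ
  have hd : ∀ x, HasDerivAt θ (g x) x := fun x =>
    intervalIntegral.integral_hasDerivAt_right (hg.intervalIntegrable _ _)
      hg.stronglyMeasurable.stronglyMeasurableAtFilter hg.continuousAt
  have hθ0 : θ 0 = 0 := by simp [hθ]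
  have hmono : StrictMono θ := strictMono_of_deriv_pos fun x => by
    rw [(hd x).deriv]
    exact hc.trans_le (hcg x)
  have hsurj : Function.Surjective θ := surjective_of_hasDerivAt_ge hd hc hcg
  set e := hmono.orderIsoOfSurjective θ hsurj with he
  have heθ : ∀ x, e x = θ x := fun x => rfl
  have hshift : ∀ x, θ (x + T) = θ x + θ T := by
    intro x
    have hz : ∀ x, HasDerivAt (fun x => θ (x + T) - θ x) 0 x := by
      intro x
      have h1 := ((hd (x + T)).comp x ((hasDerivAt_id x).add_const T)).sub (hd x)
      refine h1.congr_deriv ?_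
      rw [hper x]
      ring
    have := is_const_of_deriv_eq_zero (fun x => (hz x).differentiableAt)
      (fun x => (hz x).deriv) x 0
    simp only [zero_add, hθ0, sub_zero] at this
    linarith
  refine ⟨e.symm, e.symm.surjective, fun t => ?_, θ T, ?_, fun t => ?_⟩
  · refine HasDerivAt.of_local_left_inverse (f := θ) e.symm.continuous.continuousAt (hd _)
      (hc.trans_le (hcg _)).ne' (Eventually.of_forall fun y => ?_)
    rw [← heθ, e.apply_symm_apply]
  · rw [← hθ0]
    exact hmono hT
  · apply e.injective
    rw [e.apply_symm_apply, heθ, hshift, ← heθ (e.symm t), e.apply_symm_apply]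

variable {C S : ℝ → ℝ} {T K m : ℝ}

/-- The closed curve with inverse radius `v`. -/
noncomputable def polarCurve (C S v : ℝ → ℝ) (t : ℝ) : ℝ × ℝ :=
  ((v t ^ (-(1 / 3) : ℝ)) ^ 2 * C t, v t ^ (-(1 / 3) : ℝ) * S t)

theorem rpow_neg_third_pow_three {x : ℝ} (hx : 0 < x) : (x ^ (-(1 / 3) : ℝ)) ^ 3 = x⁻¹ := by
  rw [← Real.rpow_natCast, ← Real.rpow_mul hx.le]
  norm_num
  rw [Real.rpow_neg_one]

theorem isPeriodicOrbit_polarCurve (hq : IsQuasiTrig C S T) (hK : RadialBound K) (hm : |m| ≤ 1)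
    {v : ℝ → ℝ} (hper : Function.Periodic v T) (hv : ∀ t, K + 1 ≤ v t)
    (hd : ∀ t, HasDerivAt v (radialRate m (C t) (S t) (v t)) t) :
    IsPeriodicOrbit (planarField 1 2 m) (range (polarCurve C S v)) := by
  have hK1 := hK.one_le
  have hv0 : ∀ t, 0 < v t := fun t => by linarith [hv t]
  set ρ : ℝ → ℝ := fun t => v t ^ (-(1 / 3) : ℝ) with hρ
  have hρ0 : ∀ t, 0 < ρ t := fun t => Real.rpow_pos_of_pos (hv0 t) _
  have hρ3 : ∀ t, ρ t ^ 3 = (v t)⁻¹ := fun t => rpow_neg_third_pow_three (hv0 t)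
  have hρv : ∀ t, v t = (ρ t ^ 3)⁻¹ := fun t => by rw [hρ3, inv_inv]
  have hvc : Continuous v := continuous_iff_continuousAt.2 fun t => (hd t).continuousAt
  have hρc : Continuous ρ := hvc.rpow_const fun t => Or.inl (hv0 t).ne'
  have hX : ∀ t, 0 < 1 - ρ t ^ 3 * radialB m (C t) (S t) := by
    intro t
    have h1 := hK.one_le_sub hm (hq.curve t) (hv t)
    rw [hρ3]
    have : 1 - (v t)⁻¹ * radialB m (C t) (S t) = (v t)⁻¹ * (v t - radialB m (C t) (S t)) := by
      have := (hv0 t).ne'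
      field_simp
    rw [this]
    have := hv0 t
    positivity
  have hdρ : ∀ t, HasDerivAt ρ (ρ t ^ 4 * radialA m (C t) (S t) /
      (1 - ρ t ^ 3 * radialB m (C t) (S t))) t := by
    intro t
    have h1 := (hd t).rpow_const (p := -(1 / 3)) (Or.inl (hv0 t).ne')
    refine h1.congr_deriv ?_
    have h2 : v t ^ (-(1 / 3) - 1 : ℝ) = ρ t ^ 4 := by
      rw [Real.rpow_sub_one (hv0 t).ne', div_eq_mul_inv, ← hρ3]
      ring
    rw [h2]
    unfold radialRate
    have h3 : v t - radialB m (C t) (S t) =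
        (ρ t ^ 3)⁻¹ * (1 - ρ t ^ 3 * radialB m (C t) (S t)) := by
      rw [hρv t]
      have := (hρ0 t).ne'
      field_simp
    rw [h3, hρv t]
    have := (hρ0 t).ne'
    have := (hX t).ne'
    field_simp
  set f : ℝ → ℝ := fun t => ρ t * (1 - ρ t ^ 3 * radialB m (C t) (S t)) with hf
  have hf0 : ∀ t, 0 < f t := fun t => mul_pos (hρ0 t) (hX t)
  have hfc : Continuous f := by
    have := hq.continuous_fst
    have := hq.continuous_snd
    simp only [hf, radialB]
    fun_prop
  have hρ1 : ∀ t, ρ t ≤ 1 := by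
    intro t
    rw [← pow_le_one_iff_of_nonneg (hρ0 t).le three_ne_zero, hρ3]
    exact inv_le_one_of_one_le₀ (by linarith [hv t])
  have hf2 : ∀ t, f t ≤ 1 + K := by
    intro t
    have hB := (abs_le.1 (hK.abs_radialB_le m _ _ hm (hq.curve t))).1
    have h3 : ρ t ^ 3 ≤ 1 := pow_le_one₀ (hρ0 t).le (hρ1 t)
    have h4 : 0 ≤ ρ t ^ 3 := pow_nonneg (hρ0 t).le 3
    have h5 : 1 - ρ t ^ 3 * radialB m (C t) (S t) ≤ 1 + K := by nlinarith
    calc f t ≤ 1 * (1 - ρ t ^ 3 * radialB m (C t) (S t)) := by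
          have := (hX t).le
          simp only [hf]
          gcongr
          exact hρ1 t
      _ ≤ _ := by linarith
  have hρper : Function.Periodic ρ T := fun t => by simp only [hρ, hper t]
  have hfper : Function.Periodic f T := fun t => by
    simp only [hf, hρper t, hq.periodic_fst t, hq.periodic_snd t]
  obtain ⟨σ, hσs, hσd, P, hP, hσP⟩ := exists_time_change (g := fun t => (f t)⁻¹)
    (c := (1 + K)⁻¹) (hfc.inv₀ fun t => (hf0 t).ne') (by positivity)
    (fun t => inv_anti₀ (hf0 t) (hf2 t)) hq.pos (fun t => by simp only [hfper t])
  simp only [inv_inv] at hσd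
  refine ⟨fun t => polarCurve C S v (σ t), P, hP, fun t => ?_, fun t => ?_, ?_, ?_⟩
  · have hcs := hq.curve (σ t)
    have h1 := (hdρ (σ t)).comp t (hσd t)
    have h2 := (hq.hasDerivAt_fst (σ t)).comp t (hσd t)
    have h3 := (hq.hasDerivAt_snd (σ t)).comp t (hσd t)
    have h4 := ((h1.pow 2).mul h2).prodMk (h1.mul h3)
    refine h4.congr_deriv ?_
    change _ = planarField 1 2 m (ρ (σ t) ^ 2 * C (σ t), ρ (σ t) * S (σ t))
    have hX' := (hX (σ t)).ne'
    have hρ' := (hρ0 (σ t)).ne'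
    simp only [planarField, hf, Function.comp, Pi.pow_apply]
    have hB : radialB m (C (σ t)) (S (σ t)) =
      S (σ t) * C (σ t) ^ 3 + 2 * m * C (σ t) * S (σ t) ^ 5 := rfl
    have hA : radialA m (C (σ t)) (S (σ t)) = m * S (σ t) ^ 8 - C (σ t) ^ 4 := rfl
    generalize hBdef : radialB m (C (σ t)) (S (σ t)) = B at *
    generalize hAdef : radialA m (C (σ t)) (S (σ t)) = A at *
    generalize ρ (σ t) = r at *
    generalize C (σ t) = c at *
    generalize S (σ t) = s at *
    have e1 : r ^ 4 * A / (1 - r ^ 3 * B) * (r * (1 - r ^ 3 * B)) = r ^ 5 * A := by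
      field_simp
    rw [e1]
    refine Prod.ext ?_ ?_
    · simp only
      norm_num
      rw [hA, hB]
      linear_combination (-r ^ 6 * c ^ 3) * hcs
    · simp only
      norm_num
      rw [hA, hB]
      linear_combination (m * r ^ 5 * s ^ 5) * hcs
  · simp only [polarCurve, hσP, hper (σ t), hq.periodic_fst (σ t), hq.periodic_snd (σ t)]
  -- The orbit passes through points with `S = 1` and `S = -1`, where the second coordinates have
  -- opposite signs.
  · by_contra! hcon
    obtain ⟨a, -, ha⟩ := hq.surjective 0 1 (by norm_num)
    obtain ⟨b, -, hb⟩ := hq.surjective 0 (-1) (by norm_num)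
    obtain ⟨a', rfl⟩ := hσs a
    obtain ⟨b', rfl⟩ := hσs b
    have h1 := congrArg Prod.snd ((hcon a').trans (hcon b').symm)
    change ρ (σ a') * S (σ a') = ρ (σ b') * S (σ b') at h1
    rw [ha, hb] at h1
    linarith [hρ0 (σ a'), hρ0 (σ b')]
  · exact hσs.range_comp (polarCurve C S v)

theorem polarCurve_mem_ball (hq : IsQuasiTrig C S T) {v : ℝ → ℝ} {ε : ℝ} (hε : 0 < ε) (hε1 : ε ≤ 1)
    {t : ℝ} (hv : (ε ^ 3)⁻¹ < v t) : polarCurve C S v t ∈ Metric.ball 0 ε := by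
  have hv0 : 0 < v t := lt_trans (by positivity) hv
  have hr : v t ^ (-(1 / 3) : ℝ) < ε := by
    refine lt_of_pow_lt_pow_left₀ 3 hε.le ?_
    rw [rpow_neg_third_pow_three hv0]
    exact inv_lt_of_inv_lt₀ (by positivity) hv
  have hr0 : 0 < v t ^ (-(1 / 3) : ℝ) := Real.rpow_pos_of_pos hv0 _
  obtain ⟨hC, hS⟩ := abs_le_one_of_curve (hq.curve t)
  rw [mem_ball_zero_iff, Prod.norm_def, polarCurve]
  generalize v t ^ (-(1 / 3) : ℝ) = r at *
  refine max_lt ?_ ?_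
  · rw [Real.norm_eq_abs, abs_mul, abs_of_pos (by positivity)]
    calc r ^ 2 * |C t| ≤ r ^ 2 * 1 := by gcongr
      _ < ε := by nlinarith
  · rw [Real.norm_eq_abs, abs_mul, abs_of_pos hr0]
    calc r * |S t| ≤ r * 1 := by gcongr
      _ < ε := by linarith

/-- Polar decomposition of a solution that avoids the origin. -/
theorem exists_polar_decomposition {γ : ℝ → ℝ × ℝ}
    (hγ : IsIntegralCurve γ (fun _ => planarField 1 2 m)) (h0 : ∀ t, γ t ≠ 0) :
    ∃ ρ c s : ℝ → ℝ, (∀ t, 0 < ρ t) ∧ (∀ t, ρ t ^ 4 = 2 * (γ t).1 ^ 2 + (γ t).2 ^ 4) ∧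
      (∀ t, 2 * c t ^ 2 + s t ^ 4 = 1) ∧ (∀ t, γ t = (ρ t ^ 2 * c t, ρ t * s t)) ∧
      (∀ t, HasDerivAt ρ (ρ t ^ 5 * radialA m (c t) (s t)) t) ∧
      (∀ t, HasDerivAt c (ρ t * (1 - ρ t ^ 3 * radialB m (c t) (s t)) * s t ^ 3) t) ∧
      ∀ t, HasDerivAt s (-(ρ t * (1 - ρ t ^ 3 * radialB m (c t) (s t)) * c t)) t := by
  set n : ℝ → ℝ := fun t => 2 * (γ t).1 ^ 2 + (γ t).2 ^ 4 with hn
  have hn0 : ∀ t, 0 < n t := by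
    intro t
    have h1 : 0 ≤ (γ t).2 ^ 4 := by positivity
    refine lt_of_le_of_ne (by positivity) fun h => h0 t ?_
    have hx : (γ t).1 ^ 2 = 0 := by
      have := sq_nonneg (γ t).1
      simp only [hn] at h
      linarith
    have hy : (γ t).2 ^ 4 = 0 := by
      simp only [hn] at h
      linarith
    exact Prod.ext (pow_eq_zero_iff two_ne_zero |>.1 hx) (pow_eq_zero_iff four_ne_zero |>.1 hy)
  have hx : ∀ t, HasDerivAt (fun t => (γ t).1) ((γ t).2 ^ 3 - (γ t).1 ^ 3) t := fun t => by
    have : HasDerivAt (fun t => (γ t).1) _ t := (hγ t).fst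
    simpa [planarField] using this
  have hy : ∀ t, HasDerivAt (fun t => (γ t).2) (-(γ t).1 + m * (γ t).2 ^ 5) t := fun t => by
    have : HasDerivAt (fun t => (γ t).2) _ t := (hγ t).snd
    simpa [planarField] using this
  set ρ : ℝ → ℝ := fun t => n t ^ (1 / 4 : ℝ) with hρ
  have hρ0 : ∀ t, 0 < ρ t := fun t => Real.rpow_pos_of_pos (hn0 t) _
  have hρ4 : ∀ t, ρ t ^ 4 = n t := fun t => by
    simp only [hρ]
    rw [← Real.rpow_natCast, ← Real.rpow_mul (hn0 t).le]
    norm_num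
  set c : ℝ → ℝ := fun t => (γ t).1 / ρ t ^ 2 with hc
  set s : ℝ → ℝ := fun t => (γ t).2 / ρ t with hs
  have hxc : ∀ t, (γ t).1 = ρ t ^ 2 * c t := fun t => by
    have := (hρ0 t).ne'
    simp only [hc]
    field_simp
  have hys : ∀ t, (γ t).2 = ρ t * s t := fun t => by
    have := (hρ0 t).ne'
    simp only [hs]
    field_simp
  have hcs : ∀ t, 2 * c t ^ 2 + s t ^ 4 = 1 := by
    intro t
    have h1 := hρ4 t
    simp only [hn] at h1
    rw [hxc, hys] at h1
    have h2 : 0 < ρ t ^ 4 := pow_pos (hρ0 t) 4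
    apply mul_left_cancel₀ h2.ne'
    linear_combination -h1
  have hdρ : ∀ t, HasDerivAt ρ (ρ t ^ 5 * radialA m (c t) (s t)) t := by
    intro t
    have h1 := (((hx t).pow 2).const_mul 2).add ((hy t).pow 4)
    have h2 := HasDerivAt.rpow_const (p := 1 / 4) h1 (Or.inl (hn0 t).ne')
    refine h2.congr_deriv ?_
    have h3 : ((2 * (γ t).1 ^ 2 + (γ t).2 ^ 4) ^ (1 / 4 - 1 : ℝ)) = ρ t / ρ t ^ 4 := by
      rw [Real.rpow_sub_one (hn0 t).ne', hρ4]
    simp only [Pi.add_apply, Pi.pow_apply]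
    rw [h3, hxc, hys]
    unfold radialA
    have := (hρ0 t).ne'
    field_simp
    norm_num
    ring
  refine ⟨ρ, c, s, hρ0, hρ4, hcs, fun t => Prod.ext (hxc t) (hys t), hdρ, fun t => ?_,
    fun t => ?_⟩
  · have h1 := (hx t).div ((hdρ t).pow 2) (pow_pos (hρ0 t) 2).ne'
    refine h1.congr_deriv ?_
    have h2 := hcs t
    have h3 := (hρ0 t).ne'
    simp only [Pi.pow_apply]
    rw [hxc, hys]
    unfold radialA radialB
    generalize ρ t = r at *
    generalize c t = x at *
    generalize s t = y at *
    field_simp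
    norm_num
    linear_combination (r ^ 3 * x ^ 3) * h2
  · have h1 := (hy t).div (hdρ t) (hρ0 t).ne'
    refine h1.congr_deriv ?_
    have h2 := hcs t
    have h3 := (hρ0 t).ne'
    rw [hxc, hys]
    unfold radialA radialB
    generalize ρ t = r at *
    generalize c t = x at *
    generalize s t = y at *
    field_simp
    linear_combination (-m * r ^ 3 * y ^ 5) * h2

end Orbits

/-! ### Separation of distinct radial solutions. -/

section Isolation

theorem focal_sum_pos {K A B G J J' N p q : ℝ} (hK : 1 ≤ K) (hA : |A| ≤ K) (hB : |B| ≤ K)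
    (hG : |G| ≤ K) (hJ : |J| ≤ K) (hJ' : |J'| ≤ K) (hN : 1 / 300 ≤ N) (hp : 0 < p) (hq : 0 < q)
    (hpK : p * (20000 * K ^ 4) ≤ 1) (hqK : q * (20000 * K ^ 4) ≤ 1) :
    0 < (p + q) * N + (-(A * B ^ 3 * (p * q)) + 6 * A * G * B * (p * q) +
      J' * (p + q) * (B * (p + q) - B ^ 2 * (p * q)) -
      3 * J * A * (p * (2 * p + q) * (1 - B * q) + q * (p + 2 * q) * (1 - B * p))) := by
  have hK4 : K ≤ K ^ 4 := le_self_pow₀ hK (by norm_num)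
  have hK2 : K ^ 2 ≤ K ^ 4 := pow_le_pow_right₀ hK (by norm_num)
  have hK3 : K ^ 3 ≤ K ^ 4 := pow_le_pow_right₀ hK (by norm_num)
  have hK0 : 0 < K := by linarith
  have hp1 : p ≤ 1 := by nlinarith
  have hq1 : q ≤ 1 := by nlinarith
  have hBq : |1 - B * q| ≤ 2 := by
    have : |B * q| ≤ K * q := by rw [abs_mul, abs_of_pos hq]; gcongr
    have h2 : K * q ≤ 1 := by nlinarith
    calc |1 - B * q| ≤ |1| + |B * q| := abs_sub _ _
      _ ≤ 2 := by rw [abs_one]; linarith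
  have hBp : |1 - B * p| ≤ 2 := by
    have : |B * p| ≤ K * p := by rw [abs_mul, abs_of_pos hp]; gcongr
    have h2 : K * p ≤ 1 := by nlinarith
    calc |1 - B * p| ≤ |1| + |B * p| := abs_sub _ _
      _ ≤ 2 := by rw [abs_one]; linarith
  have hpq : 0 < p * q := mul_pos hp hq
  have hpq2 : p * q ≤ (p + q) ^ 2 := by nlinarith
  have hpq1 : p * q ≤ p + q := by nlinarith
  set Q := (p + q) ^ 2 with hQ
  have hQ0 : 0 ≤ Q := sq_nonneg _
  have hL0 : 0 ≤ K ^ 4 := by positivity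
  have e1 : |A * B ^ 3 * (p * q)| ≤ K ^ 4 * Q := by
    rw [abs_mul, abs_mul, abs_pow, abs_of_pos hpq]
    calc |A| * |B| ^ 3 * (p * q) ≤ K * K ^ 3 * Q := by gcongr
      _ = K ^ 4 * Q := by ring
  have e2 : |6 * A * G * B * (p * q)| ≤ 6 * K ^ 4 * Q := by
    rw [abs_mul, abs_mul, abs_mul, abs_mul, abs_of_pos hpq, abs_of_pos (by norm_num : (0 : ℝ) < 6)]
    calc 6 * |A| * |G| * |B| * (p * q) ≤ 6 * K * K * K * Q := by gcongr
      _ = 6 * K ^ 3 * Q := by ring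
      _ ≤ 6 * K ^ 4 * Q := by gcongr
  have e3 : |J' * (p + q) * (B * (p + q) - B ^ 2 * (p * q))| ≤ 2 * K ^ 4 * Q := by
    have i1 : |B * (p + q) - B ^ 2 * (p * q)| ≤ 2 * K ^ 2 * (p + q) := by
      refine (abs_sub _ _).trans ?_
      rw [abs_mul, abs_mul, abs_pow, abs_of_pos hpq, abs_of_pos (by linarith : 0 < p + q)]
      have i2 : |B| * (p + q) ≤ K ^ 2 * (p + q) := by
        have : |B| ≤ K ^ 2 := hB.trans (le_self_pow₀ hK (by norm_num))
        have : 0 ≤ p + q := by linarith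
        gcongr
      have i3 : |B| ^ 2 * (p * q) ≤ K ^ 2 * (p + q) := by gcongr
      linarith
    rw [abs_mul, abs_mul, abs_of_pos (by linarith : 0 < p + q)]
    calc |J'| * (p + q) * |B * (p + q) - B ^ 2 * (p * q)|
        ≤ K * (p + q) * (2 * K ^ 2 * (p + q)) := by gcongr
      _ = 2 * K ^ 3 * Q := by rw [hQ]; ring
      _ ≤ 2 * K ^ 4 * Q := by gcongr
  have e4 : |3 * J * A * (p * (2 * p + q) * (1 - B * q) + q * (p + 2 * q) * (1 - B * p))| ≤
      12 * K ^ 4 * Q := by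
    have i1 : |p * (2 * p + q) * (1 - B * q) + q * (p + 2 * q) * (1 - B * p)| ≤ 4 * Q := by
      refine (abs_add_le _ _).trans ?_
      rw [abs_mul (p * (2 * p + q)), abs_mul (q * (p + 2 * q)),
        abs_of_pos (by positivity : 0 < p * (2 * p + q)),
        abs_of_pos (by positivity : 0 < q * (p + 2 * q))]
      calc p * (2 * p + q) * |1 - B * q| + q * (p + 2 * q) * |1 - B * p|
          ≤ p * (2 * p + q) * 2 + q * (p + 2 * q) * 2 := by gcongr
        _ ≤ 4 * Q := by rw [hQ]; nlinarith
    rw [abs_mul, abs_mul, abs_mul, abs_of_pos (by norm_num : (0 : ℝ) < 3)]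
    calc 3 * |J| * |A| * |p * (2 * p + q) * (1 - B * q) + q * (p + 2 * q) * (1 - B * p)|
        ≤ 3 * K * K * (4 * Q) := by gcongr
      _ = 12 * K ^ 2 * Q := by ring
      _ ≤ 12 * K ^ 4 * Q := by gcongr
  have h1 := (abs_le.1 e1).2
  have h2 := (abs_le.1 e2).1
  have h3 := (abs_le.1 e3).1
  have h4 := (abs_le.1 e4).2
  have h5 : (p + q) * (1 / 300) ≤ (p + q) * N := by gcongr
  -- The error bounds add up to `1 + 6 + 2 + 12 = 21`, and `p + q ≤ 2 / (20000 K⁴)` makes the error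
  -- smaller than the focal term.
  have h6 : 21 * K ^ 4 * Q < (p + q) * (1 / 300) := by
    rw [hQ]
    have : 21 * K ^ 4 * (p + q) < 1 / 300 := by linarith
    nlinarith
  linarith

variable {K m : ℝ}

/-- Two distinct solutions of the radial equation, written in terms of `p = ρ ^ 3`, drift apart. -/
theorem strictMono_log_radial (hK : RadialBound K) (hm : |m| ≤ 1)
    (hf : ∀ c s : ℝ, 2 * c ^ 2 + s ^ 4 = 1 → 1 / 300 ≤ focalDensity m c s)
    {c s p q ω : ℝ → ℝ} (hω : ∀ t, 0 < ω t) (hcs : ∀ t, 2 * c t ^ 2 + s t ^ 4 = 1)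
    (hc : ∀ t, HasDerivAt c (ω t * s t ^ 3) t) (hs : ∀ t, HasDerivAt s (-(ω t * c t)) t)
    (hp0 : ∀ t, 0 < p t) (hq0 : ∀ t, 0 < q t)
    (hp1 : ∀ t, p t * (20000 * K ^ 4) ≤ 1) (hq1 : ∀ t, q t * (20000 * K ^ 4) ≤ 1)
    (hp : ∀ t, HasDerivAt p (ω t * (3 * radialA m (c t) (s t) * p t ^ 2 /
      (1 - radialB m (c t) (s t) * p t))) t)
    (hq : ∀ t, HasDerivAt q (ω t * (3 * radialA m (c t) (s t) * q t ^ 2 /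
      (1 - radialB m (c t) (s t) * q t))) t)
    (hne : ∀ t, p t ≠ q t) :
    StrictMono fun t => Real.log ((p t)⁻¹ - (q t)⁻¹) - 3 * (primAB m (s t) * (p t * q t)) -
      3 * (cubicCorr (c t) (s t) * (p t * q t * (p t + q t))) := by
  have hK1 := hK.one_le
  have hK4 : K ≤ K ^ 4 := le_self_pow₀ hK1 (by norm_num)
  -- Up to the speed, the logarithm has derivative `3AB pq / ((1 - Bp)(1 - Bq))`. Subtracting `3 G
  -- pq` and `3 J pq (p + q)` leaves `3 pq (p + q)` times the focal density plus higher order. The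
  -- mean of `A` plays no role. `Real.log` takes absolute values, so the sign of the difference is
  -- immaterial.
  have key : ∀ t, ∃ d > 0, HasDerivAt (fun t => Real.log ((p t)⁻¹ - (q t)⁻¹) -
      3 * (primAB m (s t) * (p t * q t)) -
      3 * (cubicCorr (c t) (s t) * (p t * q t * (p t + q t)))) d t := by
    intro t
    have hcst := hcs t
    have hδ : (p t)⁻¹ - (q t)⁻¹ ≠ 0 := fun h => hne t (inv_injective (sub_eq_zero.1 h))
    have h1 := hasDerivAt_primAB m (hs t) hcst
    have h2 := hasDerivAt_cubicCorr (hc t) (hs t)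
    have h3 := (((hp t).inv (hp0 t).ne').sub ((hq t).inv (hq0 t).ne')).log hδ
    have h4 := (hp t).mul (hq t)
    have h := (h3.sub ((h1.mul h4).const_mul 3)).sub
      ((h2.mul (h4.mul ((hp t).add (hq t)))).const_mul 3)
    refine ⟨_, ?_, h⟩
    have hbA := hK.abs_radialA_le m _ _ hm hcst
    have hbB := hK.abs_radialB_le m _ _ hm hcst
    have hbG := hK.abs_primAB_le m _ _ hm hcst
    have hbJ := hK.abs_cubicCorr_le _ _ hcst
    have hbJ' := hK.abs_cubicCorrDeriv_le _ _ hcst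
    have hN := hf _ _ hcst
    unfold focalDensity at hN
    have hpt := hp0 t
    have hqt := hq0 t
    have hpt1 := hp1 t
    have hqt1 := hq1 t
    have hωt := hω t
    have hnet := hne t
    have hsum := focal_sum_pos hK1 hbA hbB hbG hbJ hbJ' hN hpt hqt hpt1 hqt1
    simp only [Pi.add_apply, Pi.mul_apply, Pi.sub_apply, Pi.inv_apply]
    generalize radialA m (c t) (s t) = A at *
    generalize radialB m (c t) (s t) = B at *
    generalize cubicCorr (c t) (s t) = J at *
    generalize cubicCorrDeriv (c t) (s t) = J' at *
    generalize primAB m (s t) = G at *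
    generalize p t = x at *
    generalize q t = y at *
    generalize ω t = w at *
    have hX : 0 < 1 - B * x := by
      have := (abs_le.1 hbB).2
      nlinarith
    have hY : 0 < 1 - B * y := by
      have := (abs_le.1 hbB).2
      nlinarith
    have e : ∀ Z : ℝ, Z = 3 * w * (x * y) / ((1 - B * x) * (1 - B * y)) *
        ((x + y) * (A * B ^ 2 - 3 * A * G - J') + (-(A * B ^ 3 * (x * y)) +
          6 * A * G * B * (x * y) + J' * (x + y) * (B * (x + y) - B ^ 2 * (x * y)) -
          3 * J * A * (x * (2 * x + y) * (1 - B * y) + y * (x + 2 * y) * (1 - B * x)))) →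
        Z > 0 := by
      rintro Z rfl
      exact mul_pos (by positivity) hsum
    apply e
    have hXn := hX.ne'
    have hYn := hY.ne'
    have hyx : y - x ≠ 0 := sub_ne_zero.2 hnet.symm
    have hlog : (-(w * (3 * A * x ^ 2 / (1 - B * x))) / x ^ 2 -
        -(w * (3 * A * y ^ 2 / (1 - B * y))) / y ^ 2) / (x⁻¹ - y⁻¹) =
        3 * w * A * B * (x * y) / ((1 - B * x) * (1 - B * y)) := by
      have : x⁻¹ - y⁻¹ = (y - x) / (x * y) := by field_simp
      have i1 : -(w * (3 * A * x ^ 2 / (1 - B * x))) / x ^ 2 = -(3 * w * A / (1 - B * x)) := by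
        field_simp
      have i2 : -(w * (3 * A * y ^ 2 / (1 - B * y))) / y ^ 2 = -(3 * w * A / (1 - B * y)) := by
        field_simp
      have i3 : -(3 * w * A / (1 - B * x)) - -(3 * w * A / (1 - B * y)) =
          3 * w * A * B * (y - x) / ((1 - B * x) * (1 - B * y)) := by
        rw [neg_sub_neg, div_sub_div _ _ hYn hXn, mul_comm (1 - B * y)]
        ring
      rw [this, i1, i2, i3, div_div_eq_mul_div, div_mul_eq_mul_div, div_div,
        div_eq_div_iff (mul_ne_zero (mul_ne_zero hXn hYn) hyx) (mul_ne_zero hXn hYn)]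
      ring
    rw [hlog]
    field_simp
    ring
  refine strictMono_of_deriv_pos fun t => ?_
  obtain ⟨d, hd, h⟩ := key t
  rwa [h.deriv]

theorem eq_zero_of_hasDerivAt_mul_self {κ δ : ℝ → ℝ} (hκ : Continuous κ)
    (hδ : ∀ t, HasDerivAt δ (κ t * δ t) t) {t₀ : ℝ} (h0 : δ t₀ = 0) (t : ℝ) : δ t = 0 := by
  have hI : ∀ x, HasDerivAt (fun x => ∫ y in (0 : ℝ)..x, κ y) (κ x) x := fun x =>
    intervalIntegral.integral_hasDerivAt_right (hκ.intervalIntegrable _ _)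
      hκ.stronglyMeasurable.stronglyMeasurableAtFilter hκ.continuousAt
  have hz : ∀ x, HasDerivAt (fun x => δ x * Real.exp (-∫ y in (0 : ℝ)..x, κ y)) 0 x := by
    intro x
    refine ((hδ x).mul (hI x).neg.exp).congr_deriv ?_
    ring
  have := is_const_of_deriv_eq_zero (fun x => (hz x).differentiableAt)
    (fun x => (hz x).deriv) t t₀
  simp only [h0, zero_mul] at this
  exact (mul_eq_zero.1 this).resolve_right (Real.exp_pos _).ne'

end Isolation

/-! ### Uniqueness of the small periodic orbit and conclusion. -/

section LimitCycle

variable {C S : ℝ → ℝ} {T K m : ℝ}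

/-- Lift the angle of the given orbit to `τ` and compare its `p = ρ³` with `q = 1/v` at the same
angle. If they never meet, a strictly increasing quantity takes equal values at times `0` and `P`;
if they meet once, they coincide by uniqueness. -/
theorem periodicOrbit_eq_polarCurve (hqt : IsQuasiTrig C S T) (hK : RadialBound K) (hm : |m| ≤ 1)
    (hf : ∀ c s : ℝ, 2 * c ^ 2 + s ^ 4 = 1 → 1 / 300 ≤ focalDensity m c s)
    {v : ℝ → ℝ} (hper : Function.Periodic v T) (hv : ∀ t, 20000 * K ^ 4 ≤ v t)
    (hvd : ∀ t, HasDerivAt v (radialRate m (C t) (S t) (v t)) t)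
    {Γ : Set (ℝ × ℝ)} (hΓ : IsPeriodicOrbit (planarField 1 2 m) Γ)
    (hsmall : ∀ z ∈ Γ, z ≠ 0 ∧ ‖z‖ ≤ (20000 * K ^ 4)⁻¹ ^ 2 / 2) :
    Γ = range (polarCurve C S v) := by
  obtain ⟨γ, P, hP, hγ, hγP, -, rfl⟩ := hΓ
  have hK1 := hK.one_le
  have hK4 : K ≤ K ^ 4 := le_self_pow₀ hK1 (by norm_num)
  set L := 20000 * K ^ 4 with hL
  have hL1 : 20000 ≤ L := by linarith
  have hLK : 20000 * K ≤ L := by linarith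
  have hL0 : 0 < L := by linarith
  have hLi : L⁻¹ ≤ 1 := inv_le_one_of_one_le₀ (by linarith)
  have hLi0 : 0 < L⁻¹ := inv_pos.2 hL0
  obtain ⟨ρ, c, s, hρ0, hρ4, hcs, hpol, hρd, hcd, hsd⟩ :=
    exists_polar_decomposition hγ fun t => (hsmall _ (mem_range_self t)).1
  have hρL : ∀ t, ρ t ≤ L⁻¹ := by
    intro t
    have h1 := (hsmall _ (mem_range_self t)).2
    have hx : |(γ t).1| ≤ L⁻¹ ^ 2 / 2 := (norm_fst_le _).trans h1
    have hy : |(γ t).2| ≤ L⁻¹ ^ 2 / 2 := (norm_snd_le _).trans h1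
    refine le_of_pow_le_pow_left₀ four_ne_zero hLi0.le ?_
    rw [hρ4]
    have i1 : (γ t).1 ^ 2 ≤ (L⁻¹ ^ 2 / 2) ^ 2 := sq_le_sq' (by linarith [(abs_le.1 hx).1])
      (abs_le.1 hx).2
    have i2 : (γ t).2 ^ 2 ≤ (L⁻¹ ^ 2 / 2) ^ 2 := sq_le_sq' (by linarith [(abs_le.1 hy).1])
      (abs_le.1 hy).2
    have i3 : L⁻¹ ^ 2 ≤ 1 := pow_le_one₀ hLi0.le hLi
    have i4 : (γ t).2 ^ 2 ≤ 1 := by nlinarith [sq_nonneg L⁻¹]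
    have i5 : (γ t).2 ^ 4 ≤ (γ t).2 ^ 2 := by nlinarith [sq_nonneg (γ t).2]
    have i6 : 0 ≤ L⁻¹ ^ 4 := by positivity
    have i7 : (L⁻¹ ^ 2 / 2) ^ 2 = L⁻¹ ^ 4 / 4 := by ring
    linarith
  set p : ℝ → ℝ := fun t => ρ t ^ 3 with hp
  have hp0 : ∀ t, 0 < p t := fun t => pow_pos (hρ0 t) 3
  have hpL : ∀ t, p t * L ≤ 1 := by
    intro t
    have h1 : p t ≤ L⁻¹ := by
      calc ρ t ^ 3 ≤ L⁻¹ ^ 3 := pow_le_pow_left₀ (hρ0 t).le (hρL t) 3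
        _ ≤ L⁻¹ := pow_le_of_le_one hLi0.le hLi three_ne_zero
    rwa [← le_inv_mul_iff₀' hL0, mul_one] at *
  have hXpos : ∀ t x, 0 < x → x * L ≤ 1 → 0 < 1 - radialB m (c t) (s t) * x := by
    intro t x hx hxL
    have hB := (abs_le.1 (hK.abs_radialB_le m _ _ hm (hcs t))).2
    nlinarith
  have hXne : ∀ t, 1 - ρ t ^ 3 * radialB m (c t) (s t) ≠ 0 := fun t => by
    rw [mul_comm]
    exact (hXpos t _ (hp0 t) (hpL t)).ne'
  set ω : ℝ → ℝ := fun t => ρ t * (1 - ρ t ^ 3 * radialB m (c t) (s t)) with hω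
  have hω0 : ∀ t, 0 < ω t := fun t => by
    have := hXpos t _ (hp0 t) (hpL t)
    rw [mul_comm] at this
    exact mul_pos (hρ0 t) this
  have hρc : Continuous ρ := continuous_iff_continuousAt.2 fun t => (hρd t).continuousAt
  have hcc : Continuous c := continuous_iff_continuousAt.2 fun t => (hcd t).continuousAt
  have hsc : Continuous s := continuous_iff_continuousAt.2 fun t => (hsd t).continuousAt
  have hωc : Continuous ω := by
    simp only [hω, radialB]
    fun_prop
  have hρP : ∀ t, ρ (t + P) = ρ t := fun t => by
    have h1 := hρ4 (t + P)
    rw [hγP t, ← hρ4 t] at h1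
    exact (pow_left_inj₀ (hρ0 _).le (hρ0 _).le four_ne_zero).1 h1
  have hcP : ∀ t, c (t + P) = c t := fun t => by
    have h1 := congrArg Prod.fst (hγP t)
    rw [hpol, hpol, hρP] at h1
    exact mul_left_cancel₀ (pow_pos (hρ0 t) 2).ne' h1
  have hsP : ∀ t, s (t + P) = s t := fun t => by
    have h1 := congrArg Prod.snd (hγP t)
    rw [hpol, hpol, hρP] at h1
    exact mul_left_cancel₀ (hρ0 t).ne' h1
  have hωP : Function.Periodic ω P := fun t => by simp only [hω, hρP, hcP, hsP]
  obtain ⟨τ₀, hτC, hτS⟩ := hqt.surjective _ _ (hcs 0)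
  set τ : ℝ → ℝ := fun x => τ₀ + ∫ y in (0 : ℝ)..x, ω y with hτ
  have hτd : ∀ t, HasDerivAt τ (ω t) t := fun t =>
    (intervalIntegral.integral_hasDerivAt_right (hωc.intervalIntegrable _ _)
      hωc.stronglyMeasurable.stronglyMeasurableAtFilter hωc.continuousAt).const_add τ₀
  have hτ0 : τ 0 = τ₀ := by simp [hτ]
  have hτc : Continuous τ := continuous_iff_continuousAt.2 fun t => (hτd t).continuousAt
  have hωb : ∀ t, |ω t| ≤ 2 := by
    intro t
    have hB := (abs_le.1 (hK.abs_radialB_le m _ _ hm (hcs t))).1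
    have h1 : ρ t ≤ 1 := (hρL t).trans hLi
    have h2 : ρ t ^ 3 * (-radialB m (c t) (s t)) ≤ 1 := by
      have := hpL t
      have h3 : ρ t ^ 3 * (-radialB m (c t) (s t)) ≤ ρ t ^ 3 * L := by
        have := pow_pos (hρ0 t) 3
        gcongr
        linarith
      exact h3.trans this
    rw [abs_of_pos (hω0 t)]
    calc ω t ≤ 1 * (1 - ρ t ^ 3 * radialB m (c t) (s t)) := by
          have := hXpos t _ (hp0 t) (hpL t)
          rw [mul_comm] at this
          exact mul_le_mul_of_nonneg_right h1 this.le
      _ ≤ 2 := by linarith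
  have hlift : ∀ t, c t = C (τ t) ∧ s t = S (τ t) := by
    refine quasiTrig_unique hωb hcd hsd (c₂ := fun t => C (τ t)) (s₂ := fun t => S (τ t))
      (fun t => ?_) (fun t => ?_) hcs (fun t => hqt.curve _) (t₀ := 0)
      (by simp only [hτ0, hτC]) (by simp only [hτ0, hτS])
    · exact ((hqt.hasDerivAt_fst (τ t)).comp t (hτd t)).congr_deriv (mul_comm _ _)
    · exact ((hqt.hasDerivAt_snd (τ t)).comp t (hτd t)).congr_deriv (by ring)
  have hv0 : ∀ t, 0 < v t := fun t => hL0.trans_le (hv t)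
  set q : ℝ → ℝ := fun t => (v (τ t))⁻¹ with hq
  have hq0 : ∀ t, 0 < q t := fun t => inv_pos.2 (hv0 _)
  have hqL : ∀ t, q t * L ≤ 1 := fun t => by
    have := hv (τ t)
    rw [hq]
    simp only
    rw [inv_mul_le_iff₀ (hv0 _), mul_one]
    exact this
  have hpd : ∀ t, HasDerivAt p (ω t * (3 * radialA m (c t) (s t) * p t ^ 2 /
      (1 - radialB m (c t) (s t) * p t))) t := by
    intro t
    refine ((hρd t).pow 3).congr_deriv ?_
    have h1 := hXne t
    simp only [hω, hp]
    rw [mul_comm (radialB m (c t) (s t))]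
    generalize 1 - ρ t ^ 3 * radialB m (c t) (s t) = X at *
    field_simp
    norm_num
    ring
  have hqd : ∀ t, HasDerivAt q (ω t * (3 * radialA m (c t) (s t) * q t ^ 2 /
      (1 - radialB m (c t) (s t) * q t))) t := by
    intro t
    refine (((hvd (τ t)).comp t (hτd t)).inv (hv0 _).ne').congr_deriv ?_
    have h1 := (hXpos t _ (hq0 t) (hqL t)).ne'
    rw [← (hlift t).1, ← (hlift t).2]
    simp only [hq, Function.comp] at h1 ⊢
    unfold radialRate
    have h2 := (hv0 (τ t)).ne'
    have h3 : 1 - radialB m (c t) (s t) * (v (τ t))⁻¹ =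
        (v (τ t) - radialB m (c t) (s t)) / v (τ t) := by
      field_simp
    rw [h3] at h1 ⊢
    have h4 : v (τ t) - radialB m (c t) (s t) ≠ 0 := fun h => h1 (by rw [h, zero_div])
    generalize v (τ t) - radialB m (c t) (s t) = X at *
    field_simp
  by_cases hne : ∀ t, p t ≠ q t
  · exfalso
    have hmono := strictMono_log_radial hK hm hf hω0 hcs hcd hsd hp0 hq0 hpL hqL hpd hqd hne
    have hlt := hmono hP
    have hc0 : c P = c 0 := by simpa using hcP 0
    have hs0 : s P = s 0 := by simpa using hsP 0
    have hp0' : p P = p 0 := by simpa [hp] using congrArg (· ^ 3) (hρP 0)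
    -- The orbit may wind several times before closing; periodicity of `v` makes the number `n` of
    -- turns irrelevant.
    obtain ⟨n, hn⟩ := hqt.injective (τ 0) (τ P)
      (by rw [← (hlift 0).1, ← (hlift P).1, hc0]) (by rw [← (hlift 0).2, ← (hlift P).2, hs0])
    have hq0' : q P = q 0 := by
      simp only [hq]
      rw [hn, hper.int_mul n (τ 0)]
    simp only [hc0, hs0, hp0', hq0'] at hlt
    exact lt_irrefl _ hlt
  · push Not at hne
    obtain ⟨t₀, ht₀⟩ := hne
    have hvc : Continuous v := continuous_iff_continuousAt.2 fun t => (hvd t).continuousAt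
    have hpc : Continuous p := hρc.pow 3
    have hqc : Continuous q := (hvc.comp hτc).inv₀ fun t => (hv0 _).ne'
    have hκ : Continuous fun t => 3 * ω t * radialA m (c t) (s t) *
        (p t + q t - radialB m (c t) (s t) * p t * q t) /
        ((1 - radialB m (c t) (s t) * p t) * (1 - radialB m (c t) (s t) * q t)) := by
      refine Continuous.div ?_ ?_ fun t => mul_ne_zero (hXpos t _ (hp0 t) (hpL t)).ne'
        (hXpos t _ (hq0 t) (hqL t)).ne'
      · unfold radialA radialB
        fun_prop
      · unfold radialB
        fun_prop
    have hpq : ∀ t, p t = q t := by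
      intro t
      have := eq_zero_of_hasDerivAt_mul_self hκ (δ := fun t => p t - q t) (fun t => ?_)
        (t₀ := t₀) (sub_eq_zero.2 ht₀) t
      · exact sub_eq_zero.1 this
      · refine ((hpd t).sub (hqd t)).congr_deriv ?_
        have h1 := (hXpos t _ (hp0 t) (hpL t)).ne'
        have h2 := (hXpos t _ (hq0 t) (hqL t)).ne'
        generalize p t = x at *
        generalize q t = y at *
        generalize radialB m (c t) (s t) = B at *
        rw [← mul_sub, div_sub_div _ _ h1 h2]
        field_simp
        ring
    have hγτ : ∀ t, γ t = polarCurve C S v (τ t) := by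
      intro t
      have h1 : ρ t = v (τ t) ^ (-(1 / 3) : ℝ) := by
        have h2 := hpq t
        simp only [hp, hq] at h2
        rw [← rpow_neg_third_pow_three (hv0 _)] at h2
        exact (pow_left_inj₀ (hρ0 t).le (Real.rpow_nonneg (hv0 _).le _) three_ne_zero).1 h2
      rw [hpol, polarCurve, ← h1, (hlift t).1, (hlift t).2]
    have hsurj : Function.Surjective τ := by
      obtain ⟨t₁, -, hmin⟩ := isCompact_Icc.exists_isMinOn (nonempty_Icc.2 hP.le)
        hωc.continuousOn
      refine surjective_of_hasDerivAt_ge hτd (hω0 t₁) fun t => ?_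
      obtain ⟨r, hr, hr'⟩ := hωP.exists_mem_Ico₀ hP t
      rw [hr']
      exact hmin (Ico_subset_Icc_self hr)
    rw [← hsurj.range_comp (polarCurve C S v)]
    congr 1
    exact funext hγτ

theorem exists_limitCycle_near_critical {ε : ℝ} (hε : 0 < ε) :
    ∃ η : ℝ, 0 < η ∧ ∀ m : ℝ, 3 / 5 - η < m → m < 3 / 5 →
      ∃ Γ : Set (ℝ × ℝ), IsLimitCycle (planarField 1 2 m) Γ ∧ Γ ⊆ Metric.ball 0 ε := by
  obtain ⟨C, S, T, hqt⟩ := exists_isQuasiTrig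
  obtain ⟨K, hK⟩ := exists_radialBound
  obtain ⟨U₁, hU₁⟩ := exists_periodic_radial_solution hqt hK
  obtain ⟨η₀, hη₀, hfoc⟩ := exists_focalDensity_pos
  have hK1 := hK.one_le
  have hK4 : K ≤ K ^ 4 := le_self_pow₀ hK1 (by norm_num)
  set r := (20000 * K ^ 4)⁻¹ ^ 2 / 2 with hr
  have hr0 : 0 < r := by positivity
  set ε' := min (min ε 1) r with hε'
  have hε'0 : 0 < ε' := lt_min (lt_min hε one_pos) hr0
  -- One lower bound for `v` serves three purposes: existence of the periodic solution, smallness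
  -- for the separation estimate, and confinement of the curve to the ball of radius `ε'`.
  set U := max (max U₁ (20000 * K ^ 4)) ((ε' ^ 3)⁻¹ + 1) with hU
  have hUa : U₁ ≤ U := (le_max_left _ _).trans (le_max_left _ _)
  have hUb : 20000 * K ^ 4 ≤ U := (le_max_right _ _).trans (le_max_left _ _)
  have hUc : (ε' ^ 3)⁻¹ + 1 ≤ U := le_max_right _ _
  obtain ⟨η₁, hη₁, hsol⟩ := hU₁ U hUa
  refine ⟨min (min η₀ η₁) 1, lt_min (lt_min hη₀ hη₁) one_pos, fun m hm1 hm2 => ?_⟩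
  have g1 : min (min η₀ η₁) 1 ≤ η₀ := (min_le_left _ _).trans (min_le_left _ _)
  have g2 : min (min η₀ η₁) 1 ≤ η₁ := (min_le_left _ _).trans (min_le_right _ _)
  have g3 : min (min η₀ η₁) 1 ≤ 1 := min_le_right _ _
  have hm : |m| ≤ 1 := by
    rw [abs_le]
    constructor <;> linarith
  have hf : ∀ c s : ℝ, 2 * c ^ 2 + s ^ 4 = 1 → 1 / 300 ≤ focalDensity m c s := fun c s hcs => by
    refine hfoc m c s ?_ hcs
    rw [abs_lt]
    constructor <;> linarith
  obtain ⟨v, hper, hUv, hvd⟩ := hsol m (by linarith) hm2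
  have hball : range (polarCurve C S v) ⊆ Metric.ball 0 ε' := by
    rintro _ ⟨t, rfl⟩
    exact polarCurve_mem_ball hqt hε'0 ((min_le_left _ _).trans (min_le_right _ _))
      (by linarith [hUv t])
  have hnz : (0 : ℝ × ℝ) ∉ range (polarCurve C S v) := by
    rintro ⟨t, ht⟩
    have hv0 : 0 < v t := by
      have := hUv t
      linarith
    have hρ := Real.rpow_pos_of_pos hv0 (-(1 / 3))
    have hC : C t = 0 := by
      have := congrArg Prod.fst ht
      exact (mul_eq_zero.1 this).resolve_left (pow_pos hρ 2).ne'
    have hS : S t = 0 := by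
      have := congrArg Prod.snd ht
      exact (mul_eq_zero.1 this).resolve_left hρ.ne'
    have := hqt.curve t
    rw [hC, hS] at this
    norm_num at this
  -- The isolating neighbourhood is the punctured ball, so that orbits inside it have polar
  -- coordinates.
  refine ⟨range (polarCurve C S v), ⟨?_, Metric.ball 0 ε' \ {0}, ?_, ?_, ?_⟩, ?_⟩
  · exact isPeriodicOrbit_polarCurve hqt hK hm hper (fun t => by linarith [hUv t]) hvd
  · exact Metric.isOpen_ball.sdiff isClosed_singleton
  · exact fun z hz => ⟨hball hz, fun h => hnz (by rw [← mem_singleton_iff.1 h]; exact hz)⟩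
  · intro Γ' hΓ' hsub
    refine periodicOrbit_eq_polarCurve hqt hK hm hf hper (fun t => hUb.trans (hUv t)) hvd hΓ'
      fun z hz => ⟨(hsub hz).2, ?_⟩
    have := mem_ball_zero_iff.1 (hsub hz).1
    exact this.le.trans (min_le_right _ _)
  · exact hball.trans (Metric.ball_subset_ball ((min_le_left _ _).trans (min_le_left _ _)))

end LimitCycle

theorem theorem3 :
    -- Case `s < 2k`.
    (∀ (k s : ℕ) (m : ℝ), 1 ≤ k → 1 ≤ s → s < 2 * k →
      (m < 0 → IsAttractor (planarField k s m) 0) ∧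
      (0 < m → IsRepeller (planarField k s m) 0)) ∧
    -- Case `s > 2k`.
    (∀ (k s : ℕ) (m : ℝ), 1 ≤ k → 1 ≤ s → 2 * k < s →
      IsAttractor (planarField k s m) 0) ∧
    -- Case `s = 2k`.
    (∀ (k s : ℕ) (m : ℝ), 1 ≤ k → 1 ≤ s → s = 2 * k →
      (m < (Nat.doubleFactorial (2 * k + 1) : ℝ) / (quadFactorial (4 * k + 1) : ℝ) →
        IsAttractor (planarField k s m) 0) ∧
      ((Nat.doubleFactorial (2 * k + 1) : ℝ) / (quadFactorial (4 * k + 1) : ℝ) < m →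
        IsRepeller (planarField k s m) 0)) ∧
    -- The critical value of `m` for `k = 1`, `s = 2`.
    IsRepeller (planarField 1 2 (3 / 5)) 0 ∧
    -- Bifurcation: limit cycles arbitrarily close to the origin as `m` increases to `3/5`.
    (∀ ε : ℝ, 0 < ε → ∃ η : ℝ, 0 < η ∧ ∀ m : ℝ, 3 / 5 - η < m → m < 3 / 5 →
      ∃ Γ : Set (ℝ × ℝ), IsLimitCycle (planarField 1 2 m) Γ ∧ Γ ⊆ Metric.ball 0 ε) := by
  refine ⟨fun k s m hk hs hks => ⟨isAttractor_planarField_of_lt hk hs,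
    isRepeller_planarField_of_lt hk hs hks⟩, fun k s m hk hs hks =>
    isAttractor_planarField_of_gt m hk hs hks, ?_, isRepeller_planarField_critical,
    fun ε hε => exists_limitCycle_near_critical hε⟩
  rintro k _ m hk - rfl
  rw [← reductionCoeff_eq k]
  exact ⟨isAttractor_planarField_of_lt_critical hk, isRepeller_planarField_of_gt_critical hk⟩
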